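/- **Setting.** Let $r\ge 1$ be an integer and let $F_r$ be the class of functions $f=1/g:\mathbb R\to\mathbb R$ such that $g\in C^r(\mathbb R)$, each of $g$ and $g^{(r)}$ is strictly positive on all of $\mathbb R$ or strictly negative on all of $\mathbb R$, and $f$ is Lipschitz on $\mathbb R$. Let $f\in F_r$, $a<b$, $\eta\in\mathbb R$, and let $z$ be the solution of $z'(t)=f(z(t))$, $t\in[a,b]$, $z(a)=\eta$. **Constant.** Put $C_2=1/12$; for even $r\ge 4$ put $C_r=\int_0^1 (x-\bar p_0)^2(x-\bar p_1)\cdots(x-\bar p_{r-2})\,dx$ with $\bar p_j=j/(r-2)$; for odd $r$ put $C_r=\int_{1-1/r}^1 (x-\bar p_0)\cdots(x-\bar p_{r-1})\,dx$ with $\bar p_j=j/r$. **Reference quantity.** For $a\le s\le t\le b$ let $$p(s,t)=\sup_{y}\frac{|g^{(r)}(y)|}{|g(y)|^{r+2}}\cdot\frac{|C_r|}{r!}\,(t-s)^{r+1},$$ the supremum being over all $y$ between $z(s)$ and $z(t)$ (inclusive). For $m\ge1$ let $k_m^*=\inf\max_{0\le i\le m-1}p(x_i,x_{i+1})$ over all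 $a=x_0\le x_1\le\dots\le x_m=b$. For $\varepsilon>0$ let $m(\varepsilon)$ be the least $m\ge 1$ with $k_m^*\le\varepsilon$. **Algorithm ADMESH.** Given $\varepsilon>0$ and $\alpha\in(0,1/2)$, start from $(\hat x_0,\hat y_0)=(a,\eta)$. Let $\sigma=1$ if $f>0$ and $\sigma=-1$ if $f<0$. The $i$-th pass ($i=0,1,\dots$) is as follows. 1. Evaluate $f$ at the $r+1$ equidistant points $\bar z_j=\hat y_i+\sigma\varepsilon^{1/(r+1)}j/r$, $j=0,\dots,r$, and compute the divided difference $d=g[\bar z_0,\dots,\bar z_r]$ and $\hat c_i=2^{r+1}|d|\,|f(\hat y_i)|^{r+2}$. 2. Put $\hat x_{i+1}=\min\{b,\ \hat x_i+2\,(|C_r|\,\hat c_i\,(1-\alpha))^{-1/(r+1)}\varepsilon^{1/(r+1)}\}$, $h=\hat x_{i+1}-\hat x_i$ and $\bar y_i=\hat y_i+2f(\hat y_i)h$. 3. Let $\hat g_i$ be the Lagrange interpolation polynomial of $g$ of degree at most $r-1$ at the $r$ equidistant points of the interval with end points $\hat y_i,\bar y_i$, end points included (for $r=1$: the constant $g(\hat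 y_i)$). The value $f(\hat y_i)$ is reused, so this takes $r-1$ further evaluations of $f$. 4. Let $l_i\ge1$ be the least integer with $$\frac{8|f(\hat y_i)|}{\hat c_i^{1/(r+1)}|C_r|^{1/(r+1)}}\Big(\frac1{1-\alpha}\Big)^{1/(r+1)}\varepsilon^{1/(r+1)-1}\le 2^{l_i}.$$ Apply $l_i$ steps of bisection to the equation $\int_{\hat y_i}^{y}\hat g_i(s)\,ds=h$, starting from the interval with end points $\hat y_i,\bar y_i$, and take for $\hat y_{i+1}$ any point of the last bisection interval. 5. Stop if $\hat x_{i+1}=b$; otherwise begin the next pass. Let $\hat m$ be the first index with $\hat x_{\hat m}=b$, and let $\mathrm{cost}(f,\alpha,\varepsilon)$ be the number of evaluations of $f$ made by the algorithm. **Theorem 1.** Let $f\in F_r$, $a<b$, $\eta\in\mathbb R$ and $\alpha\in(0,1/2)$. There is $\varepsilon_0>0$, depending only on $f,a,b,\eta,\alpha$ (and $r$), such that for every $0<\varepsilon\le\varepsilon_0$ and every selection of the points in step 4, ADMESH stops after finitely many passes, and $$\max_{0\le i\le\hat m-1}|\hat y_{i+1}-z_i(\hat x_{i+1})|\le\Big(\frac{1+\alpha}{1-\alpha}\cdot\frac{2^{r+1}}{|C_r|}+\frac12\Big)\varepsilon,\qquad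 \mathrm{cost}(f,\alpha,\varepsilon)\le 2r\,m(\varepsilon),$$ where $z_i$ is the solution of $z_i'(t)=f(z_i(t))$ on $[\hat x_i,\hat x_{i+1}]$ with $z_i(\hat x_i)=\hat y_i$. -/

import Mathlib

namespace ADMESH

/-- `h` is strictly positive on all of `ℝ` or strictly negative on all of `ℝ`. -/
def HasConstantSign (h : ℝ → ℝ) : Prop :=
  (∀ y, 0 < h y) ∨ (∀ y, h y < 0)

/-- The class `F_r` of right-hand sides `f = 1/g`, with `g ∈ C^r(ℝ)`, with `g` and its `r`-th
derivative of constant sign on `ℝ`, and with `f` Lipschitz on `ℝ`. -/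
def classF (r : ℕ) : Set (ℝ → ℝ) :=
  {f | ∃ g : ℝ → ℝ, ContDiff ℝ r g ∧ HasConstantSign g ∧ HasConstantSign (iteratedDeriv r g) ∧
    (∀ y, f y = 1 / g y) ∧ ∃ L : NNReal, LipschitzWith L f}

/-- The constant `C_r` of the Newton-Cotes type remainder. For even `r ≥ 4` it is
`∫₀¹ (x - p₀)² (x - p₁) ⋯ (x - p_{r-2}) dx` with the `r - 1` equidistant nodes
`p_j = j / (r - 2)` of `[0, 1]` (so `p₀ = 0`); for `r = 2` it is `1/12`; for odd `r` it is
`∫_{1-1/r}^1 (x - p₀) ⋯ (x - p_{r-1}) dx` with `p_j = j / r`. -/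
noncomputable def constC (r : ℕ) : ℝ :=
  if r = 2 then 1 / 12
  else if Even r then
    ∫ x in (0 : ℝ)..1, x * ∏ j ∈ Finset.range (r - 1), (x - (j : ℝ) / ((r : ℝ) - 2))
  else
    ∫ x in (1 - 1 / (r : ℝ))..1, ∏ j ∈ Finset.range r, (x - (j : ℝ) / (r : ℝ))

/-! ### The reference quantities `k_m^*` and `m(ε)` -/

/-- `c̄(s, t) (t - s)^{r+1}`, where
`c̄(s, t) = sup_{y between z(s) and z(t)} (|g^{(r)}(y)| / |g(y)|^{r+2}) |C_r| / r!`. -/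
noncomputable def localErr (r : ℕ) (g z : ℝ → ℝ) (s t : ℝ) : ℝ :=
  sSup ((fun y => |iteratedDeriv r g y| / |g y| ^ (r + 2)) '' Set.uIcc (z s) (z t))
    * |constC r| / (r.factorial : ℝ) * (t - s) ^ (r + 1)

/-- `k_m^*`: the infimum over all `a = x_0 ≤ x_1 ≤ ⋯ ≤ x_m = b` of
`max_{0 ≤ i ≤ m-1} c̄(x_i, x_{i+1}) (x_{i+1} - x_i)^{r+1}` (used for `m ≥ 1`). -/
noncomputable def kStar (r : ℕ) (g z : ℝ → ℝ) (a b : ℝ) (m : ℕ) : ℝ :=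
  sInf {k : ℝ | ∃ x : Fin (m + 1) → ℝ, Monotone x ∧ x 0 = a ∧ x (Fin.last m) = b ∧
    k = ⨆ i : Fin m, localErr r g z (x i.castSucc) (x i.succ)}

/-- `m(ε)`: the least `m ≥ 1` with `k_m^* ≤ ε`. -/
noncomputable def mOf (r : ℕ) (g z : ℝ → ℝ) (a b ε : ℝ) : ℕ :=
  sInf {m : ℕ | 1 ≤ m ∧ kStar r g z a b m ≤ ε}

/-! ### Programs that query values of `f`, and their cost -/

/-- A program that can obtain information about a function `ℝ → ℝ` only by asking for its values
at points of its choice; arithmetic on reals is free. -/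
inductive Prog (β : Type) : Type
  | ret (c : β) : Prog β
  | ask (y : ℝ) (k : ℝ → Prog β) : Prog β

/-- Sequential composition. -/
def Prog.bind {β γ : Type} : Prog β → (β → Prog γ) → Prog γ
  | .ret c, q => q c
  | .ask y k, q => .ask y (fun v => (k v).bind q)

/-- The result of a program when its queries are answered by `f`. -/
def Prog.value {β : Type} (f : ℝ → ℝ) : Prog β → β
  | .ret c => c
  | .ask y k => (k (f y)).value f

/-- The number of evaluations of `f` made by a program when its queries are answered by `f`. -/
def Prog.cost {β : Type} (f : ℝ → ℝ) : Prog β → ℕ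
  | .ret _ => 0
  | .ask y k => (k (f y)).cost f + 1

/-- Ask for the values at `n` given points. -/
def askAll : (n : ℕ) → (Fin n → ℝ) → Prog (Fin n → ℝ)
  | 0, _ => .ret Fin.elim0
  | n + 1, p => .ask (p 0) fun v =>
      (askAll n (fun j => p j.succ)).bind fun w => .ret (Fin.cons v w)

/-! ### The algorithm -/

/-- The `j`-th of the `n + 1` equidistant points of the interval with end points `u`, `v`, starting
from `u` (for `n = 0` the only point is `u`). -/
noncomputable def node (u v : ℝ) (n j : ℕ) : ℝ := u + (v - u) * ((j : ℝ) / (n : ℝ))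

/-- The divided difference over the nodes `p` with the values `v`:
`∑_j v_j / ∏_{i ≠ j} (p_j - p_i)`. -/
noncomputable def dividedDiff {n : ℕ} (p v : Fin n → ℝ) : ℝ :=
  ∑ j, v j / ∏ i ∈ Finset.univ.erase j, (p j - p i)

/-- The bisection method for `F y = h`, with `l` steps, from an interval with end points `u`, `v`
where `F u < h ≤ F v`. -/
noncomputable def bisect (F : ℝ → ℝ) (h : ℝ) : ℕ → ℝ → ℝ → ℝ × ℝ
  | 0, u, v => (u, v)
  | l + 1, u, v =>
      if F ((u + v) / 2) < h then bisect F h l ((u + v) / 2) v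
      else bisect F h l u ((u + v) / 2)

/-- The number of bisection steps: the least `l ≥ 1` with
`8 |f(y)| / (c^{1/(r+1)} |C_r|^{1/(r+1)}) (1/(1-α))^{1/(r+1)} ε^{1/(r+1)-1} ≤ 2^l`. -/
noncomputable def bisecSteps (r : ℕ) (α ε fy c : ℝ) : ℕ :=
  sInf {l : ℕ | 1 ≤ l ∧
    8 * |fy| / (c ^ (1 / ((r : ℝ) + 1)) * |constC r| ^ (1 / ((r : ℝ) + 1)))
      * (1 / (1 - α)) ^ (1 / ((r : ℝ) + 1)) * ε ^ (1 / ((r : ℝ) + 1) - 1) ≤ 2 ^ l}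

/-- One pass through the loop: from `(x̂_i, ŷ_i)` to `(x̂_{i+1}, ŷ_{i+1})`. The point of the last
bisection interval that is taken as `ŷ_{i+1}` is the one with relative position `θ ∈ [0, 1]`.

For positive `f` the sign `σ` is `1` and the absolute values of `f` can be dropped; for negative `f`
this is the reflected procedure, the one for `y ↦ -f (-y)` with `ŷ_i` replaced by `-ŷ_i`. -/
noncomputable def step (r : ℕ) (α b ε θ : ℝ) (p : ℝ × ℝ) : Prog (ℝ × ℝ) :=
  let x := p.1
  let y := p.2
  -- `f (y)` is computed once and used throughout
  .ask y fun fy =>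
    let σ : ℝ := (SignType.sign fy : ℝ)
    let yEnd := y + σ * ε ^ (1 / ((r : ℝ) + 1))
    -- the other `r` values for the divided difference of `g = 1/f`
    (askAll r fun j => node y yEnd r (j + 1)).bind fun v =>
      let d := dividedDiff (fun j : Fin (r + 1) => node y yEnd r j)
        (Fin.cons (1 / fy) fun j => 1 / v j)
      let c := 2 ^ (r + 1) * |d| * |fy| ^ (r + 2)
      let x' := min b (x + 2 / (|constC r| * c * (1 - α)) ^ (1 / ((r : ℝ) + 1))
        * ε ^ (1 / ((r : ℝ) + 1)))
      let yBar := y + 2 * fy * (x' - x)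
      -- the other `r - 1` values for the interpolation polynomial
      (askAll (r - 1) fun j => node y yBar (r - 1) (j + 1)).bind fun w =>
        let vals : Fin r → ℝ := fun j =>
          if hj : (j : ℕ) = 0 then 1 / fy else 1 / w ⟨j - 1, by omega⟩
        let gHat : Polynomial ℝ :=
          Lagrange.interpolate Finset.univ (fun j : Fin r => node y yBar (r - 1) j) vals
        let I := bisect (fun t => ∫ s in y..t, gHat.eval s) (x' - x) (bisecSteps r α ε fy c) y yBar
        .ret (x', I.1 + θ * (I.2 - I.1))

/-- The pairs `(x̂_i, ŷ_i)` produced by the algorithm for `f`, starting from `(a, η)`; `θ i` is the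
selection made in the `i`-th pass. -/
noncomputable def pair (f : ℝ → ℝ) (r : ℕ) (α a b η ε : ℝ) (θ : ℕ → ℝ) : ℕ → ℝ × ℝ
  | 0 => (a, η)
  | i + 1 => (step r α b ε (θ i) (pair f r α a b η ε θ i)).value f

/-- The algorithm stops after `n` passes: `n` is the first index with `x̂_n = b`. -/
def StopsAfter (f : ℝ → ℝ) (r : ℕ) (α a b η ε : ℝ) (θ : ℕ → ℝ) (n : ℕ) : Prop :=
  IsLeast {i : ℕ | (pair f r α a b η ε θ i).1 = b} n

/-- The number of evaluations of `f` in the first `n` passes. -/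
noncomputable def totalCost (f : ℝ → ℝ) (r : ℕ) (α a b η ε : ℝ) (θ : ℕ → ℝ) (n : ℕ) : ℕ :=
  ∑ i ∈ Finset.range n, (step r α b ε (θ i) (pair f r α a b η ε θ i)).cost f

end ADMESH

namespace ADMESH

/-! The autonomous equation separates: along a solution, `∫ u in z s..z t, g u = t - s`
(`integral_along_integralCurve`). A pass solves `∫ s in y..w, g s = h` with `g` replaced by its
interpolant. The residual is at most about `|g^(r)(y)| / r! * (2|f(y)|h)^(r+1)`; multiplying by
`|f(y)|` turns it into an error in `y` of about `2^(r+1)/r! * density * h^(r+1)`. The divided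
difference makes `ĉ` nearly `2^(r+1)/r! * density`, so the uncut length `H` satisfies `density *
|C_r|/r! * (1-α) * H^(r+1) ≈ ε`. This gives the local error bound, with `ε/2` added by bisection.
All the approximations become factors `Λ` near `1` on a compact set (`exists_nearlyConstant`,
`exists_passEstimates`).

Globally no Gronwall argument is needed: `∫ s in y..y', g s` is additive over passes, so residuals
of relative size `κ` sum to at most `κ * (x - a)` (`pair_invariant`). This keeps the iterates near
`z`, and since uncut lengths are bounded below, the algorithm stops.

Each pass costs exactly `2r` evaluations, so it remains to bound the number of passes by `m = m(ε)`.
If there were more, `x̂_m < b`, and any mesh with `m` intervals would have one containing some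
`[x̂_i, x̂_{i+1}]` (`exists_interval_subset`). On it the reference error is at least `ε/(1-α²)`,
hence `k_m^* > ε` (`le_kStar`), a contradiction. -/

/-! ### Nonvanishing of the constant `C_r` -/

open Finset in
/-- The node polynomial of the integers `-k, …, k`. -/
noncomputable def centralProd (k : ℕ) (s : ℝ) : ℝ := ∏ j ∈ range (2 * k + 1), (s + k - j)

lemma continuous_centralProd (k : ℕ) : Continuous (centralProd k) := by
  unfold centralProd; fun_prop

lemma centralProd_neg (k : ℕ) (s : ℝ) : centralProd k (-s) = -centralProd k s := by
  unfold centralProd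
  rw [← Finset.prod_range_reflect]
  have h : ∀ j ∈ Finset.range (2 * k + 1),
      (-s + k - ((2 * k + 1 - 1 - j : ℕ) : ℝ)) = (-1) * (s + k - j) := by
    intro j hj
    have : j ≤ 2 * k := by have := Finset.mem_range.1 hj; omega
    rw [Nat.add_sub_cancel, Nat.cast_sub this]
    push_cast; ring
  rw [Finset.prod_congr rfl h, Finset.prod_mul_distrib]
  simp [pow_succ, pow_mul]

lemma centralProd_add_one (k : ℕ) (s : ℝ) :
    centralProd k (s + 1) * (s - k) = centralProd k s * (s + k + 1) := by
  unfold centralProd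
  rw [Finset.prod_range_succ', Finset.prod_range_succ]
  have h : ∀ j ∈ Finset.range (2 * k), (s + 1 + k - ((j + 1 : ℕ) : ℝ)) = s + k - j := by
    intro j _; push_cast; ring
  rw [Finset.prod_congr rfl h]
  push_cast; ring

lemma centralProd_sign_zero (k : ℕ) {s : ℝ} (hs : s ∈ Set.Ioo (0 : ℝ) 1) :
    0 < (-1) ^ k * centralProd k s := by
  unfold centralProd
  rw [show 2 * k + 1 = (k + 1) + k by ring, Finset.prod_range_add]
  have h : (-1 : ℝ) ^ k = ∏ j ∈ Finset.range k, (-1 : ℝ) := by simp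
  rw [h, mul_left_comm, ← Finset.prod_mul_distrib]
  apply mul_pos
  · apply Finset.prod_pos
    intro j hj
    have : (j : ℝ) ≤ k := by exact_mod_cast Nat.lt_succ_iff.1 (Finset.mem_range.1 hj)
    linarith [hs.1]
  · apply Finset.prod_pos
    intro j _
    push_cast
    have : (0 : ℝ) ≤ j := by positivity
    linarith [hs.2]

/-- By `centralProd_add_one`, a unit shift multiplies the product by `(s + k + 1)/(s - k)`, which is
negative for `0 < s < k`; the sign alternates from one unit interval to the next. -/
lemma centralProd_sign (k m : ℕ) (hm : m < k) {s : ℝ} (hs : s ∈ Set.Ioo (0 : ℝ) 1) :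
    0 < (-1) ^ (k + m) * centralProd k (m + s) := by
  induction m with
  | zero => simpa using centralProd_sign_zero k hs
  | succ m ih =>
    have h1 := ih (by omega)
    have h2 := centralProd_add_one k (m + s)
    have hk : (m : ℝ) + 1 + 1 ≤ k := by exact_mod_cast hm
    have h3 : 0 < k - (m + s) := by linarith [hs.2]
    have h4 : 0 < (m + s) + k + 1 := by have := hs.1; positivity
    have h5 : 0 < ((-1) ^ (k + (m + 1)) * centralProd k ((m + 1 : ℕ) + s)) * (k - (m + s)) := by
      have : ((-1) ^ (k + (m + 1)) * centralProd k ((m + 1 : ℕ) + s)) * (k - (m + s))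
          = ((-1) ^ (k + m) * centralProd k (m + s)) * ((m + s) + k + 1) := by
        have e : ((m + 1 : ℕ) : ℝ) + s = m + s + 1 := by push_cast; ring
        rw [e, ← add_assoc, pow_succ]
        linear_combination (-1) ^ (k + m) * h2
      rw [this]; positivity
    exact pos_of_mul_pos_left h5 h3.le

/-- The shift ratio has modulus `(s + k + 1)/(k - s) > 1` for `s > 0`, so the magnitudes grow away
from the centre. -/
lemma centralProd_lt_add_one (k m : ℕ) (hm : m + 1 < k) {s : ℝ} (hs : s ∈ Set.Ioo (0 : ℝ) 1) :
    (-1) ^ (k + m) * ((m + s) * centralProd k (m + s))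
      < (-1) ^ (k + (m + 1)) * (((m + 1 : ℕ) + s) * centralProd k ((m + 1 : ℕ) + s)) := by
  have h1 := centralProd_sign k m (by omega) hs
  have h1' := centralProd_sign k (m + 1) hm hs
  have h2 := centralProd_add_one k (m + s)
  have e : ((m + 1 : ℕ) : ℝ) + s = m + s + 1 := by push_cast; ring
  rw [e] at h1' ⊢
  set A := (-1) ^ (k + m) * centralProd k (m + s) with hA
  set B := (-1) ^ (k + (m + 1)) * centralProd k (m + s + 1) with hB
  have hk : (m : ℝ) + 1 + 1 ≤ k := by exact_mod_cast hm
  have hm0 : (0 : ℝ) ≤ m := by positivity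
  have h5 : B * (k - (m + s)) = A * ((m + s) + k + 1) := by
    rw [hA, hB, ← add_assoc, pow_succ]
    linear_combination (-1) ^ (k + m) * h2
  have hAB : A ≤ B := by
    by_contra hlt
    push Not at hlt
    nlinarith [hs.1, hs.2]
  have hs0 := hs.1
  calc _ = (m + s) * A := by rw [hA]; ring
    _ ≤ (m + s) * B := by gcongr
    _ < (m + s + 1) * B := by nlinarith
    _ = _ := by rw [hB]; ring

/-- The integrals over successive unit intervals alternate in sign with increasing magnitude, so
each partial sum has the sign of its last term. The bound by that last term is what carries the
induction. -/
lemma integral_mul_centralProd_pos (k m : ℕ) (hm : m < k) :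
    0 < (-1) ^ (k + m) * ∫ s in (0 : ℝ)..(m + 1 : ℕ), s * centralProd k s ∧
    (-1) ^ (k + m) * ∫ s in (0 : ℝ)..(m + 1 : ℕ), s * centralProd k s
      ≤ ∫ s in (0 : ℝ)..1, (-1) ^ (k + m) * ((m + s) * centralProd k (m + s)) := by
  have hc := continuous_centralProd k
  have hshift : ∀ m : ℕ, ∫ s in (0 : ℝ)..1, (-1) ^ (k + m) * ((m + s) * centralProd k (m + s))
      = (-1) ^ (k + m) * ∫ s in (m : ℝ)..(m + 1 : ℕ), s * centralProd k s := by
    intro m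
    rw [intervalIntegral.integral_const_mul,
      intervalIntegral.integral_comp_add_left (fun s => s * centralProd k s)]
    simp
  have hint : ∀ m : ℕ, IntervalIntegrable
      (fun s : ℝ => (-1) ^ (k + m) * ((m + s) * centralProd k (m + s)))
      MeasureTheory.volume 0 1 := fun m => (by fun_prop : Continuous _).intervalIntegrable _ _
  induction m with
  | zero =>
    have h := hshift 0
    simp only [Nat.cast_zero] at h
    rw [← h]
    refine ⟨?_, by simp⟩
    refine intervalIntegral.intervalIntegral_pos_of_pos_on (by simpa using hint 0) ?_ one_pos
    intro s hs
    have := centralProd_sign k 0 hm hs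
    simp only [Nat.cast_zero] at this
    have h0 := hs.1
    rw [mul_left_comm]
    exact mul_pos (by linarith) this
  | succ m ih =>
    obtain ⟨ih1, ih2⟩ := ih (by omega)
    have hsplit : ∫ s in (0 : ℝ)..(m + 1 + 1 : ℕ), s * centralProd k s
        = (∫ s in (0 : ℝ)..(m + 1 : ℕ), s * centralProd k s)
          + ∫ s in ((m + 1 : ℕ) : ℝ)..(m + 1 + 1 : ℕ), s * centralProd k s :=
      (intervalIntegral.integral_add_adjacent_intervals
        ((by fun_prop : Continuous _).intervalIntegrable _ _)
        ((by fun_prop : Continuous _).intervalIntegrable _ _)).symm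
    have hD : ∫ s in (0 : ℝ)..1, (-1) ^ (k + m) * ((m + s) * centralProd k (m + s))
        < ∫ s in (0 : ℝ)..1,
          (-1) ^ (k + (m + 1)) * (((m + 1 : ℕ) + s) * centralProd k ((m + 1 : ℕ) + s)) := by
      rw [← sub_pos, ← intervalIntegral.integral_sub (hint (m + 1)) (hint m)]
      refine intervalIntegral.intervalIntegral_pos_of_pos_on
        ((hint (m + 1)).sub (hint m)) ?_ one_pos
      intro s hs
      exact sub_pos.2 (centralProd_lt_add_one k m hm hs)
    have hsh := hshift (m + 1)
    have e : (-1 : ℝ) ^ (k + (m + 1)) * ∫ s in (0 : ℝ)..(m + 1 + 1 : ℕ), s * centralProd k s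
        = (∫ s in (0 : ℝ)..1,
          (-1) ^ (k + (m + 1)) * (((m + 1 : ℕ) + s) * centralProd k ((m + 1 : ℕ) + s)))
        - (-1) ^ (k + m) * ∫ s in (0 : ℝ)..(m + 1 : ℕ), s * centralProd k s := by
      rw [hsplit, hsh, ← add_assoc, pow_succ]
      ring
    rw [e]
    constructor <;> linarith

/-- Rescaling to `[-k, k]` turns the integrand into a multiple of `(s + k) * centralProd k s`. As
`centralProd k` is odd, the part with `k` integrates to zero and the other is twice the integral
over `[0, k]`. -/
lemma integral_newtonCotes_even (k : ℕ) (hk : 1 ≤ k) :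
    ∫ x in (0 : ℝ)..1, x * ∏ j ∈ Finset.range (2 * k + 1), (x - (j : ℝ) / (2 * k)) ≠ 0 := by
  have hk0 : (0 : ℝ) < k := by exact_mod_cast hk
  have hc := continuous_centralProd k
  set F : ℝ → ℝ := fun x => x * ∏ j ∈ Finset.range (2 * k + 1), (x - (j : ℝ) / (2 * k)) with hF
  have hFs : ∀ s : ℝ, F (s / (2 * k) + 1 / 2)
      = (1 / (2 * k)) ^ (2 * k + 2) * ((s + k) * centralProd k s) := by
    intro s
    have h1 : ∀ j ∈ Finset.range (2 * k + 1),
        (s / (2 * k) + 1 / 2 - (j : ℝ) / (2 * k)) = (1 / (2 * k)) * (s + k - j) := by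
      intro j _
      field_simp
    simp only [hF]
    rw [Finset.prod_congr rfl h1, Finset.prod_mul_distrib, Finset.prod_const, Finset.card_range,
      centralProd]
    have h2 : s / (2 * k) + 1 / 2 = (1 / (2 * k)) * (s + k) := by field_simp
    rw [h2]; ring
  have h1 : ∫ s in (-k : ℝ)..k, F (s / (2 * k) + 1 / 2) = (2 * k) * ∫ x in (0 : ℝ)..1, F x := by
    rw [intervalIntegral.integral_comp_div_add F (by positivity)]
    congr 2 <;> field_simp <;> norm_num
  have hI : ∫ s in (-k : ℝ)..k, (s + k) * centralProd k s
      = 2 * ∫ s in (0 : ℝ)..k, s * centralProd k s := by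
    have hi : ∀ u v : ℝ, IntervalIntegrable (fun s => (s + k) * centralProd k s)
        MeasureTheory.volume u v := fun u v => (by fun_prop : Continuous _).intervalIntegrable _ _
    rw [← intervalIntegral.integral_add_adjacent_intervals (hi (-k) 0) (hi 0 k)]
    have h2 : ∫ s in (-k : ℝ)..0, (s + k) * centralProd k s
        = ∫ s in (0 : ℝ)..k, (-s + k) * centralProd k (-s) := by
      rw [intervalIntegral.integral_comp_neg (fun s => (s + k) * centralProd k s)]
      simp
    rw [h2, ← intervalIntegral.integral_add
      ((by fun_prop : Continuous _).intervalIntegrable _ _) (hi 0 k),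
      ← intervalIntegral.integral_const_mul]
    congr 1
    ext s
    rw [centralProd_neg]; ring
  obtain ⟨n, rfl⟩ : ∃ n, k = n + 1 := ⟨k - 1, by omega⟩
  have hpos := (integral_mul_centralProd_pos (n + 1) n (by omega)).1
  intro h0
  rw [h0, mul_zero] at h1
  simp only [hFs] at h1
  rw [intervalIntegral.integral_const_mul, hI] at h1
  have h3 : ∫ s in (0 : ℝ)..(n + 1 : ℕ), s * centralProd (n + 1) s = 0 := by
    rcases mul_eq_zero.1 h1 with h | h
    · exact absurd h (by positivity)
    · linarith
  rw [h3, mul_zero] at hpos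
  exact lt_irrefl _ hpos

theorem constC_ne_zero (r : ℕ) (hr : 1 ≤ r) : constC r ≠ 0 := by
  unfold constC
  split_ifs with h2 he
  · norm_num
  · obtain ⟨k, rfl⟩ : ∃ k, r = 2 * k + 2 := by
      obtain ⟨m, hm⟩ := he
      exact ⟨m - 1, by omega⟩
    have := integral_newtonCotes_even k (by omega)
    have e : ((2 * k + 2 : ℕ) : ℝ) - 2 = 2 * k := by push_cast; ring
    rw [e]
    exact this
  -- For odd `r` all nodes are at most `1 - 1/r`, so the integrand is positive on the interval of
  -- integration.
  · have hr0 : (0 : ℝ) < r := by exact_mod_cast hr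
    refine (intervalIntegral.intervalIntegral_pos_of_pos_on
      ((by fun_prop : Continuous _).intervalIntegrable _ _) ?_ ?_).ne'
    · intro x hx
      apply Finset.prod_pos
      intro j hj
      have hj' : (j : ℝ) + 1 ≤ r := by exact_mod_cast Finset.mem_range.1 hj
      have : (j : ℝ) / r ≤ 1 - 1 / r := by
        rw [div_le_iff₀ hr0, sub_mul, div_mul_cancel₀ _ hr0.ne']; linarith
      linarith [hx.1]
    · have : 0 < 1 / (r : ℝ) := by positivity
      linarith

/-! ### Divided differences and the interpolation remainder -/

open Polynomial in
lemma iteratedDeriv_polynomial_eval (Q : ℝ[X]) (n : ℕ) :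
    iteratedDeriv n (fun x => Q.eval x) = fun x => (derivative^[n] Q).eval x := by
  induction n with
  | zero => simp
  | succ n ih =>
    rw [iteratedDeriv_succ, ih]
    ext x
    rw [Polynomial.deriv, Function.iterate_succ_apply']

open Polynomial in
lemma iteratedDeriv_polynomial_eval_of_natDegree_le {Q : ℝ[X]} {n : ℕ} (hQ : Q.natDegree ≤ n)
    (x : ℝ) : iteratedDeriv n (fun x => Q.eval x) x = n.factorial * Q.coeff n := by
  rw [iteratedDeriv_polynomial_eval]
  have h0 : (derivative^[n] Q).natDegree = 0 := by
    have := natDegree_iterate_derivative Q n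
    omega
  simp only
  rw [eq_C_of_natDegree_eq_zero h0, eval_C, coeff_iterate_derivative]
  simp [Nat.descFactorial_self]

/-- Iterated Rolle: the zeros of the derivative between consecutive zeros are again strictly
ordered. -/
lemma exists_iteratedDeriv_eq_zero_of_strictMono {n : ℕ} {h : ℝ → ℝ} (hh : ContDiff ℝ n h)
    {u v : ℝ} (p : Fin (n + 1) → ℝ) (hp : StrictMono p) (hmem : ∀ i, p i ∈ Set.Icc u v)
    (h0 : ∀ i, h (p i) = 0) : ∃ ξ ∈ Set.Icc u v, iteratedDeriv n h ξ = 0 := by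
  induction n generalizing h with
  | zero => exact ⟨p 0, hmem 0, by simpa using h0 0⟩
  | succ n ih =>
    have hlt : ∀ i : Fin (n + 1), p i.castSucc < p i.succ := fun i =>
      hp (Fin.castSucc_lt_succ)
    have hex : ∀ i : Fin (n + 1), ∃ c ∈ Set.Ioo (p i.castSucc) (p i.succ), deriv h c = 0 :=
      fun i => exists_deriv_eq_zero (hlt i) hh.continuous.continuousOn (by rw [h0, h0])
    choose c hc hc0 using hex
    have hcm : StrictMono c := by
      rw [Fin.strictMono_iff_lt_succ]
      intro i
      calc c i.castSucc < p i.castSucc.succ := (hc _).2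
        _ = p i.succ.castSucc := by rw [Fin.succ_castSucc]
        _ < c i.succ := (hc _).1
    have hd : ContDiff ℝ n (deriv h) := by
      have : ContDiff ℝ ((n : WithTop ℕ∞) + 1) h := by exact_mod_cast hh
      exact (contDiff_succ_iff_deriv.1 this).2.2
    obtain ⟨ξ, hξ, hξ0⟩ := ih hd c hcm
      (fun i => ⟨(hmem i.castSucc).1.trans (hc i).1.le, (hc i).2.le.trans (hmem i.succ).2⟩) hc0
    exact ⟨ξ, hξ, by rw [iteratedDeriv_succ']; exact hξ0⟩

open Polynomial in
lemma exists_iteratedDeriv_eq_factorial_mul_coeff {n : ℕ} {g : ℝ → ℝ} (hg : ContDiff ℝ n g)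
    {u v : ℝ} {S : Finset ℝ} (hS : S.card = n + 1) (hmem : ∀ x ∈ S, x ∈ Set.uIcc u v)
    {Q : ℝ[X]} (hQ : Q.natDegree ≤ n) (heq : ∀ x ∈ S, g x = Q.eval x) :
    ∃ ξ ∈ Set.uIcc u v, iteratedDeriv n g ξ = n.factorial * Q.coeff n := by
  have hQc : ContDiff ℝ n (fun x => Q.eval x) := by
    exact Q.contDiff_aeval (𝕜 := ℝ) (n : WithTop ℕ∞)
  obtain ⟨ξ, hξ, h0⟩ := exists_iteratedDeriv_eq_zero_of_strictMono (hg.sub hQc)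
    (u := u ⊓ v) (v := u ⊔ v) (S.orderEmbOfFin hS) (S.orderEmbOfFin hS).strictMono
    (fun i => hmem _ (S.orderEmbOfFin_mem hS i))
    (fun i => sub_eq_zero.2 (heq _ (S.orderEmbOfFin_mem hS i)))
  refine ⟨ξ, hξ, ?_⟩
  rw [show (fun y => g y - (fun x => Q.eval x) y) = g - fun x => Q.eval x from rfl,
    iteratedDeriv_sub hg.contDiffAt hQc.contDiffAt,
    iteratedDeriv_polynomial_eval_of_natDegree_le hQ] at h0
  linarith

open Polynomial in
-- The divided difference is the coefficient of degree `r` of the interpolant at the `r + 1` nodes,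
-- to which iterated Rolle applies.
lemma exists_dividedDiff_eq {r : ℕ} {g : ℝ → ℝ} (hg : ContDiff ℝ r g) {u v : ℝ}
    {p : Fin (r + 1) → ℝ} (hp : Function.Injective p) (hmem : ∀ i, p i ∈ Set.uIcc u v) :
    ∃ ξ ∈ Set.uIcc u v, dividedDiff p (fun j => g (p j)) = iteratedDeriv r g ξ / r.factorial := by
  set Q := Lagrange.interpolate Finset.univ p (fun j => g (p j)) with hQ
  have hinj : Set.InjOn p (Finset.univ : Finset (Fin (r + 1))) := hp.injOn
  have hdeg : Q.degree < (Finset.univ : Finset (Fin (r + 1))).card :=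
    Lagrange.degree_interpolate_lt _ hinj
  have heval : ∀ i, Q.eval (p i) = g (p i) := fun i =>
    Lagrange.eval_interpolate_at_node _ hinj (Finset.mem_univ i)
  have hcoeff := Lagrange.coeff_eq_sum hinj hdeg
  simp only [heval, Finset.card_univ, Fintype.card_fin, Nat.add_sub_cancel] at hcoeff
  have hnat : Q.natDegree ≤ r := by
    rw [Finset.card_univ, Fintype.card_fin] at hdeg
    rcases eq_or_ne Q 0 with h | h
    · simp [h]
    · exact Nat.lt_succ_iff.1 ((natDegree_lt_iff_degree_lt h).2 hdeg)
  obtain ⟨ξ, hξ, h⟩ := exists_iteratedDeriv_eq_factorial_mul_coeff hg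
    (S := Finset.univ.image p) (by rw [Finset.card_image_of_injective _ hp]; simp)
    (by simpa using hmem) hnat (by simp [heval])
  refine ⟨ξ, hξ, ?_⟩
  have hf : (r.factorial : ℝ) ≠ 0 := by positivity
  rw [h, mul_div_cancel_left₀ _ hf, hcoeff, dividedDiff]

open Polynomial in
lemma abs_sub_interpolate_le {r : ℕ} {g : ℝ → ℝ} (hg : ContDiff ℝ r g) {u v M : ℝ}
    {p : Fin r → ℝ} (hp : Function.Injective p) (hmem : ∀ i, p i ∈ Set.uIcc u v)
    (hM : ∀ ξ ∈ Set.uIcc u v, |iteratedDeriv r g ξ| ≤ M) {s : ℝ} (hs : s ∈ Set.uIcc u v) :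
    |g s - (Lagrange.interpolate Finset.univ p (fun j => g (p j))).eval s|
      ≤ M / r.factorial * |v - u| ^ r := by
  set P := Lagrange.interpolate Finset.univ p (fun j => g (p j)) with hP
  have hM0 : 0 ≤ M := (abs_nonneg _).trans (hM s hs)
  have hinj : Set.InjOn p (Finset.univ : Finset (Fin r)) := hp.injOn
  have heval : ∀ i, P.eval (p i) = g (p i) := fun i =>
    Lagrange.eval_interpolate_at_node _ hinj (Finset.mem_univ i)
  by_cases hsp : ∃ i, p i = s
  · obtain ⟨i, rfl⟩ := hsp
    rw [heval, sub_self, abs_zero]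
    positivity
  push Not at hsp
  have hdeg : P.degree < r := by
    have h := Lagrange.degree_interpolate_lt (fun j => g (p j)) hinj
    rwa [Finset.card_univ, Fintype.card_fin] at h
  set N := Lagrange.nodal Finset.univ p with hN
  have hNs : N.eval s = ∏ i, (s - p i) := Lagrange.eval_nodal
  have hN0 : N.eval s ≠ 0 := by
    rw [hNs]; exact Finset.prod_ne_zero_iff.2 fun i _ => sub_ne_zero.2 (hsp i).symm
  have hNdeg : N.natDegree = r := by simp [hN, Lagrange.natDegree_nodal]
  have hNmonic : N.Monic := Lagrange.nodal_monic
  -- Adding this multiple of the nodal polynomial makes `Q` agree with `g` at `s` as well as at the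
  -- nodes, so Rolle has `r + 1` zeros and identifies `c` with a derivative value.
  set c := (g s - P.eval s) / N.eval s with hc
  set Q := P + C c * N with hQ
  have hPr : P.coeff r = 0 := coeff_eq_zero_of_degree_lt hdeg
  have hQr : Q.coeff r = c := by
    rw [hQ, coeff_add, hPr, coeff_C_mul, ← hNdeg, hNmonic.coeff_natDegree]; ring
  have hQdeg : Q.natDegree ≤ r := by
    refine natDegree_add_le_of_degree_le (natDegree_le_of_degree_le hdeg.le) ?_
    exact (natDegree_C_mul_le _ _).trans hNdeg.le
  have hQs : Q.eval s = g s := by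
    rw [hQ, eval_add, eval_mul, eval_C, hc, div_mul_cancel₀ _ hN0]; ring
  have hQp : ∀ i, Q.eval (p i) = g (p i) := by
    intro i
    rw [hQ, eval_add, eval_mul, hN, Lagrange.eval_nodal_at_node (Finset.mem_univ i), heval]
    simp
  have hnot : s ∉ Finset.univ.image p := by simpa using hsp
  obtain ⟨ξ, hξ, h⟩ := exists_iteratedDeriv_eq_factorial_mul_coeff hg
    (S := insert s (Finset.univ.image p))
    (by rw [Finset.card_insert_of_notMem hnot, Finset.card_image_of_injective _ hp]; simp)
    (u := u) (v := v) (by simpa [hs] using hmem) hQdeg (by simp [hQs, hQp])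
  have hf : (0 : ℝ) < r.factorial := by positivity
  have hcM : |c| ≤ M / r.factorial := by
    rw [le_div_iff₀ hf, ← abs_of_pos hf, ← abs_mul, mul_comm, ← hQr, ← h]
    exact hM ξ hξ
  have hprod : |N.eval s| ≤ |v - u| ^ r := by
    rw [hNs, Finset.abs_prod]
    calc ∏ i, |s - p i| ≤ ∏ _i : Fin r, |v - u| :=
          Finset.prod_le_prod (fun _ _ => abs_nonneg _)
            fun i _ => Set.abs_sub_le_of_uIcc_subset_uIcc (Set.uIcc_subset_uIcc (hmem i) hs)
      _ = |v - u| ^ r := by simp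
  calc |g s - P.eval s| = |c| * |N.eval s| := by
        rw [← abs_mul, hc, div_mul_cancel₀ _ hN0]
    _ ≤ M / r.factorial * |v - u| ^ r := by gcongr

/-! ### Cost and result of a single pass as a program -/

lemma Prog.cost_bind {β γ : Type} (f : ℝ → ℝ) (p : Prog β) (k : β → Prog γ) :
    (p.bind k).cost f = p.cost f + (k (p.value f)).cost f := by
  induction p with
  | ret c => simp [Prog.bind, Prog.cost, Prog.value]
  | ask y k' ih => simp only [Prog.bind, Prog.cost, Prog.value, ih]; ring

lemma Prog.value_bind {β γ : Type} (f : ℝ → ℝ) (p : Prog β) (k : β → Prog γ) :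
    (p.bind k).value f = (k (p.value f)).value f := by
  induction p with
  | ret c => simp [Prog.bind, Prog.value]
  | ask y k' ih => simp only [Prog.bind, Prog.value, ih]

lemma askAll_cost (f : ℝ → ℝ) (n : ℕ) (p : Fin n → ℝ) : (askAll n p).cost f = n := by
  induction n with
  | zero => rfl
  | succ n ih => simp [askAll, Prog.cost, Prog.cost_bind, ih]

lemma askAll_value (f : ℝ → ℝ) (n : ℕ) (p : Fin n → ℝ) :
    (askAll n p).value f = fun j => f (p j) := by
  induction n with
  | zero => exact Subsingleton.elim _ _
  | succ n ih =>
    simp only [askAll, Prog.value, Prog.value_bind, ih]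
    ext j
    refine Fin.cases ?_ (fun j => ?_) j <;> simp

lemma step_cost (f : ℝ → ℝ) {r : ℕ} (hr : 1 ≤ r) (α b ε θ : ℝ) (p : ℝ × ℝ) :
    (step r α b ε θ p).cost f = 2 * r := by
  simp only [step, Prog.cost, Prog.cost_bind, askAll_cost]
  -- The count is `1 + r + (r - 1)`; `1 ≤ r` makes the truncated subtraction exact.
  omega

lemma node_zero (u v : ℝ) (n : ℕ) : node u v n 0 = u := by simp [node]

/-- The quantity `ĉ` computed in a pass that starts from `y`. -/
noncomputable def errorCoeff (f : ℝ → ℝ) (r : ℕ) (ε y : ℝ) : ℝ :=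
  2 ^ (r + 1) *
    |dividedDiff (fun j : Fin (r + 1) =>
        node y (y + (SignType.sign (f y) : ℝ) * ε ^ (1 / ((r : ℝ) + 1))) r j)
      (fun j : Fin (r + 1) =>
        1 / f (node y (y + (SignType.sign (f y) : ℝ) * ε ^ (1 / ((r : ℝ) + 1))) r j))|
    * |f y| ^ (r + 2)

/-- The length of a pass that is not cut off at the right end point. -/
noncomputable def passLength (f : ℝ → ℝ) (r : ℕ) (α ε y : ℝ) : ℝ :=
  2 / (|constC r| * errorCoeff f r ε y * (1 - α)) ^ (1 / ((r : ℝ) + 1))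
    * ε ^ (1 / ((r : ℝ) + 1))

/-- The interpolation polynomial of `1 / f` at the `r` equidistant points of the interval with
end points `u`, `v`. -/
noncomputable def nodeInterpolant (f : ℝ → ℝ) (r : ℕ) (u v : ℝ) : Polynomial ℝ :=
  Lagrange.interpolate Finset.univ (fun j : Fin r => node u v (r - 1) j)
    (fun j : Fin r => 1 / f (node u v (r - 1) j))

lemma step_value (f : ℝ → ℝ) (r : ℕ) (α b ε θ x y : ℝ) {x' yBar : ℝ}
    (hx' : x' = min b (x + passLength f r α ε y)) (hyBar : yBar = y + 2 * f y * (x' - x))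
    {I : ℝ × ℝ}
    (hI : I = bisect (fun t => ∫ s in y..t, (nodeInterpolant f r y yBar).eval s) (x' - x)
      (bisecSteps r α ε (f y) (errorCoeff f r ε y)) y yBar) :
    (step r α b ε θ (x, y)).value f = (x', I.1 + θ * (I.2 - I.1)) := by
  have hcons : ∀ yEnd : ℝ,
      (Fin.cons (1 / f y) fun j : Fin r => 1 / f (node y yEnd r ((j : ℕ) + 1)) :
        Fin (r + 1) → ℝ) = fun j : Fin (r + 1) => 1 / f (node y yEnd r j) := by
    intro yEnd
    ext j
    refine Fin.cases ?_ (fun j => ?_) j <;> simp [node_zero]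
  have hvals : ∀ yB : ℝ,
      (fun j : Fin r => if _hj : (j : ℕ) = 0 then 1 / f y
        else 1 / f (node y yB (r - 1) (((j : ℕ) - 1) + 1)))
        = fun j : Fin r => 1 / f (node y yB (r - 1) j) := by
    intro yB
    ext j
    split_ifs with hj
    · rw [hj, node_zero]
    · rw [Nat.sub_add_cancel (Nat.one_le_iff_ne_zero.2 hj)]
  subst hI hyBar hx'
  simp only [step, Prog.value, Prog.value_bind, askAll_value, hcons, hvals, passLength, errorCoeff,
    nodeInterpolant]

/-! ### Bisection, mean values of integrals, and nodes -/

/-- The strict and weak inequalities at the two ends are invariant under halving. For negative `f`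
the end points come in decreasing order, hence unordered intervals throughout. -/
lemma bisect_spec (F : ℝ → ℝ) (h : ℝ) (l : ℕ) (u v : ℝ) (hu : F u < h) (hv : h ≤ F v) :
    F (bisect F h l u v).1 < h ∧ h ≤ F (bisect F h l u v).2 ∧
      (bisect F h l u v).1 ∈ Set.uIcc u v ∧ (bisect F h l u v).2 ∈ Set.uIcc u v ∧
      |(bisect F h l u v).2 - (bisect F h l u v).1| = |v - u| / 2 ^ l := by
  induction l generalizing u v with
  | zero => simp [bisect, hu, hv]
  | succ l ih =>
    have hmid : (u + v) / 2 ∈ Set.uIcc u v := by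
      rw [Set.mem_uIcc]
      rcases le_total u v with h | h
      · left; constructor <;> linarith
      · right; constructor <;> linarith
    rw [bisect]
    split_ifs with hm
    · obtain ⟨h1, h2, h3, h4, h5⟩ := ih _ _ hm hv
      have hsub : Set.uIcc ((u + v) / 2) v ⊆ Set.uIcc u v :=
        Set.uIcc_subset_uIcc hmid Set.right_mem_uIcc
      refine ⟨h1, h2, hsub h3, hsub h4, ?_⟩
      rw [h5, show v - (u + v) / 2 = (v - u) / 2 by ring, abs_div, abs_two, pow_succ]
      field_simp
    · obtain ⟨h1, h2, h3, h4, h5⟩ := ih _ _ hu (not_lt.1 hm)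
      have hsub : Set.uIcc u ((u + v) / 2) ⊆ Set.uIcc u v :=
        Set.uIcc_subset_uIcc Set.left_mem_uIcc hmid
      refine ⟨h1, h2, hsub h3, hsub h4, ?_⟩
      rw [h5, show (u + v) / 2 - u = (v - u) / 2 by ring, abs_div, abs_two, pow_succ]
      field_simp

lemma exists_integral_eq_mul {g : ℝ → ℝ} (hg : Continuous g) (u v : ℝ) :
    ∃ ξ ∈ Set.uIcc u v, ∫ s in u..v, g s = g ξ * (v - u) := by
  have hd : ∀ x, HasDerivAt (fun t => ∫ s in u..t, g s) (g x) x := fun x =>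
    intervalIntegral.integral_hasDerivAt_right (hg.intervalIntegrable _ _)
      (hg.stronglyMeasurableAtFilter _ _) hg.continuousAt
  have hc : Continuous (fun t => ∫ s in u..t, g s) :=
    continuous_iff_continuousAt.2 fun x => (hd x).continuousAt
  rcases lt_trichotomy u v with h | h | h
  · obtain ⟨ξ, hξ, he⟩ := exists_hasDerivAt_eq_slope _ g h hc.continuousOn fun x _ => hd x
    refine ⟨ξ, by rw [Set.uIcc_of_le h.le]; exact Set.Ioo_subset_Icc_self hξ, ?_⟩
    rw [he]
    have : v - u ≠ 0 := (sub_pos.2 h).ne'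
    field_simp
    simp
  · exact ⟨u, Set.left_mem_uIcc, by simp [h]⟩
  · obtain ⟨ξ, hξ, he⟩ := exists_hasDerivAt_eq_slope _ g h hc.continuousOn fun x _ => hd x
    refine ⟨ξ, by rw [Set.uIcc_of_ge h.le]; exact Set.Ioo_subset_Icc_self hξ, ?_⟩
    rw [he]
    have : u - v ≠ 0 := (sub_pos.2 h).ne'
    field_simp
    simp only [intervalIntegral.integral_same]
    ring

/-- A point of the last bisection interval is close to a point where the equation holds. -/
lemma exists_root_near_bisect {F : ℝ → ℝ} (hF : Continuous F) {h : ℝ} (l : ℕ) {u v : ℝ}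
    (hu : F u < h) (hv : h ≤ F v) {θ : ℝ} (hθ : θ ∈ Set.Icc (0 : ℝ) 1) :
    ∃ Y ∈ Set.uIcc u v, F Y = h ∧
      (bisect F h l u v).1 + θ * ((bisect F h l u v).2 - (bisect F h l u v).1) ∈ Set.uIcc u v ∧
      |(bisect F h l u v).1 + θ * ((bisect F h l u v).2 - (bisect F h l u v).1) - Y|
        ≤ |v - u| / 2 ^ l := by
  obtain ⟨h1, h2, h3, h4, h5⟩ := bisect_spec F h l u v hu hv
  set I := bisect F h l u v
  obtain ⟨Y, hY, hYh⟩ := intermediate_value_uIcc (a := I.1) (b := I.2) hF.continuousOn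
    (Set.mem_uIcc.2 (Or.inl ⟨h1.le, h2⟩))
  have hmem : I.1 + θ * (I.2 - I.1) ∈ Set.uIcc I.1 I.2 := by
    rw [Set.mem_uIcc]
    obtain ⟨hθ0, hθ1⟩ := hθ
    rcases le_total I.1 I.2 with h | h
    · left; constructor <;> nlinarith
    · right; constructor <;> nlinarith
  have hsub := Set.uIcc_subset_uIcc h3 h4
  refine ⟨Y, hsub hY, hYh, hsub hmem, ?_⟩
  rw [← h5]
  exact Set.abs_sub_le_of_uIcc_subset_uIcc (Set.uIcc_subset_uIcc hY hmem)

lemma node_mem_uIcc (u v : ℝ) {n j : ℕ} (hj : j ≤ n) : node u v n j ∈ Set.uIcc u v := by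
  have h0 : (0 : ℝ) ≤ (j : ℝ) / n := by positivity
  have h1 : (j : ℝ) / n ≤ 1 := div_le_one_of_le₀ (by exact_mod_cast hj) (by positivity)
  rw [Set.mem_uIcc, node]
  rcases le_total u v with h | h
  · left; constructor <;> nlinarith
  · right; constructor <;> nlinarith

lemma node_injective {u v : ℝ} (huv : u ≠ v) {N n : ℕ} (hN : N ≤ n + 1) :
    Function.Injective (fun j : Fin N => node u v n j) := by
  rcases Nat.eq_zero_or_pos n with rfl | hn
  · have : Subsingleton (Fin N) := Fin.subsingleton_iff_le_one.2 hN
    exact Function.injective_of_subsingleton _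
  · intro i j hij
    have hn' : (n : ℝ) ≠ 0 := by exact_mod_cast hn.ne'
    have hvu : v - u ≠ 0 := sub_ne_zero.2 huv.symm
    simp only [node, add_right_inj, mul_eq_mul_left_iff, hvu, or_false] at hij
    rw [div_left_inj' hn'] at hij
    exact Fin.ext (by exact_mod_cast hij)

lemma abs_sub_le_of_mem_uIcc {u v s : ℝ} (hs : s ∈ Set.uIcc u v) : |s - u| ≤ |v - u| :=
  Set.abs_sub_le_of_uIcc_subset_uIcc (Set.uIcc_subset_uIcc Set.left_mem_uIcc hs)

/-! ### Near-constancy and the estimates for one pass -/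

/-- `h` changes at most by the factor `Λ` over distances up to `ρ` from `y`. -/
def NearlyConstant (h : ℝ → ℝ) (Λ ρ y : ℝ) : Prop :=
  ∀ s, |s - y| ≤ ρ → |h s| ≤ Λ * |h y| ∧ |h y| ≤ Λ * |h s|

/-- The local error density `|g^{(r)}| / |g|^{r+2}`. -/
noncomputable def density (r : ℕ) (g : ℝ → ℝ) (y : ℝ) : ℝ :=
  |iteratedDeriv r g y| / |g y| ^ (r + 2)

lemma exists_errorCoeff_eq {r : ℕ} {f g : ℝ → ℝ} (hg : ContDiff ℝ r g)
    (hg0 : ∀ y, g y ≠ 0) (hf : ∀ y, f y = 1 / g y) {ε : ℝ} (hε : 0 < ε) (y : ℝ) :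
    ∃ ξ, |ξ - y| ≤ ε ^ (1 / ((r : ℝ) + 1)) ∧
      errorCoeff f r ε y
        = 2 ^ (r + 1) * (|iteratedDeriv r g ξ| / r.factorial) * |f y| ^ (r + 2) := by
  set q := ε ^ (1 / ((r : ℝ) + 1)) with hq
  have hq0 : 0 < q := Real.rpow_pos_of_pos hε _
  have hσ : |((SignType.sign (f y) : SignType) : ℝ)| = 1 := by
    have : f y ≠ 0 := by rw [hf]; exact one_div_ne_zero (hg0 y)
    rcases this.lt_or_gt with h | h
    · rw [sign_neg h]; simp
    · rw [sign_pos h]; simp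
  set v := y + ((SignType.sign (f y) : SignType) : ℝ) * q with hv
  have hvy : |v - y| = q := by rw [hv, add_sub_cancel_left, abs_mul, hσ, one_mul, abs_of_pos hq0]
  have hne : y ≠ v := by
    intro h
    rw [← h, sub_self, abs_zero] at hvy
    exact hq0.ne hvy
  obtain ⟨ξ, hξ, h⟩ := exists_dividedDiff_eq hg (u := y) (v := v)
    (p := fun j : Fin (r + 1) => node y v r j) (node_injective hne le_rfl)
    (fun j => node_mem_uIcc _ _ (Nat.lt_succ_iff.1 j.2))
  refine ⟨ξ, hvy ▸ abs_sub_le_of_mem_uIcc hξ, ?_⟩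
  have hfg : ∀ y, 1 / f y = g y := fun y => by rw [hf, one_div_one_div]
  rw [errorCoeff]
  simp only [hfg]
  rw [h, abs_div, Nat.abs_cast]

lemma errorCoeff_bounds {r : ℕ} {f g : ℝ → ℝ} (hg : ContDiff ℝ r g)
    (hg0 : ∀ y, g y ≠ 0) (hf : ∀ y, f y = 1 / g y) {ε : ℝ} (hε : 0 < ε) {y Λ ρ : ℝ}
    (hD : NearlyConstant (iteratedDeriv r g) Λ ρ y)
    (hρ : ε ^ (1 / ((r : ℝ) + 1)) ≤ ρ) :
    2 ^ (r + 1) / r.factorial * density r g y ≤ Λ * errorCoeff f r ε y ∧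
      errorCoeff f r ε y ≤ Λ * (2 ^ (r + 1) / r.factorial * density r g y) := by
  obtain ⟨ξ, hξ, h⟩ := exists_errorCoeff_eq hg hg0 hf hε y
  obtain ⟨h1, h2⟩ := hD ξ (hξ.trans hρ)
  have hfy : |f y| ^ (r + 2) = 1 / |g y| ^ (r + 2) := by
    rw [hf, abs_div, abs_one, div_pow, one_pow]
  have hgy : 0 < |g y| ^ (r + 2) := pow_pos (abs_pos.2 (hg0 y)) _
  have hfac : (0 : ℝ) < r.factorial := by positivity
  rw [h, hfy, density]
  constructor
  · calc (2 : ℝ) ^ (r + 1) / r.factorial * (|iteratedDeriv r g y| / |g y| ^ (r + 2))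
        ≤ 2 ^ (r + 1) / r.factorial * (Λ * |iteratedDeriv r g ξ| / |g y| ^ (r + 2)) := by gcongr
      _ = _ := by ring
  · calc (2 : ℝ) ^ (r + 1) * (|iteratedDeriv r g ξ| / r.factorial) * (1 / |g y| ^ (r + 2))
        ≤ 2 ^ (r + 1) * (Λ * |iteratedDeriv r g y| / r.factorial) * (1 / |g y| ^ (r + 2)) := by
          gcongr
      _ = _ := by ring

lemma rpow_one_div_succ_pow (r : ℕ) {x : ℝ} (hx : 0 ≤ x) :
    (x ^ (1 / ((r : ℝ) + 1))) ^ (r + 1) = x := by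
  have := Real.rpow_inv_natCast_pow hx (Nat.succ_ne_zero r)
  push_cast at this
  rwa [one_div]

lemma passLength_pow {f : ℝ → ℝ} {r : ℕ} {α ε y : ℝ} (hε : 0 ≤ ε) (hα : α ≤ 1)
    (hc : 0 ≤ errorCoeff f r ε y) :
    passLength f r α ε y ^ (r + 1)
      = 2 ^ (r + 1) / (|constC r| * errorCoeff f r ε y * (1 - α)) * ε := by
  have h1 : 0 ≤ 1 - α := by linarith
  rw [passLength, mul_pow, div_pow, rpow_one_div_succ_pow r hε,
    rpow_one_div_succ_pow r (by positivity)]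

lemma passLength_pos {f : ℝ → ℝ} {r : ℕ} (hr : 1 ≤ r) {α ε y : ℝ} (hε : 0 < ε) (hα : α < 1)
    (hc : 0 < errorCoeff f r ε y) : 0 < passLength f r α ε y := by
  have h1 : 0 < 1 - α := by linarith
  have h2 := abs_pos.2 (constC_ne_zero r hr)
  unfold passLength
  positivity

/-- The stopping rule in usable form: since the initial bracket has length at most `2 * |f y| *
passLength`, the last one has length at most `ε / 2`. -/
lemma two_pow_bisecSteps {f : ℝ → ℝ} {r : ℕ} {α ε y : ℝ} (hε : 0 < ε) (hα : α < 1)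
    (hc : 0 ≤ errorCoeff f r ε y) :
    4 * |f y| * passLength f r α ε y
      ≤ ε * 2 ^ bisecSteps r α ε (f y) (errorCoeff f r ε y) := by
  set c := errorCoeff f r ε y with hcdef
  set e : ℝ := 1 / ((r : ℝ) + 1) with he
  have h1 : 0 < 1 - α := by linarith
  set S : Set ℕ := {l : ℕ | 1 ≤ l ∧
    8 * |f y| / (c ^ e * |constC r| ^ e) * (1 / (1 - α)) ^ e * ε ^ (e - 1) ≤ 2 ^ l} with hS
  have hne : S.Nonempty := by
    obtain ⟨l, hl⟩ := pow_unbounded_of_one_lt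
      (8 * |f y| / (c ^ e * |constC r| ^ e) * (1 / (1 - α)) ^ e * ε ^ (e - 1)) (one_lt_two (α := ℝ))
    exact ⟨l + 1, Nat.le_add_left _ _, hl.le.trans (pow_le_pow_right₀ one_le_two (Nat.le_succ l))⟩
  have hmem : 8 * |f y| / (c ^ e * |constC r| ^ e) * (1 / (1 - α)) ^ e * ε ^ (e - 1)
      ≤ 2 ^ bisecSteps r α ε (f y) c := (Nat.sInf_mem hne).2
  have hpl : 4 * |f y| * passLength f r α ε y
      = ε * (8 * |f y| / (c ^ e * |constC r| ^ e) * (1 / (1 - α)) ^ e * ε ^ (e - 1)) := by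
    rw [passLength, ← hcdef, ← he, Real.mul_rpow (by positivity) h1.le,
      Real.mul_rpow (abs_nonneg _) hc, Real.div_rpow zero_le_one h1.le, Real.one_rpow,
      Real.rpow_sub_one hε.ne']
    field_simp
    ring
  rw [hpl]
  exact mul_le_mul_of_nonneg_left hmem hε.le

lemma eq_of_integral_eq_zero {g : ℝ → ℝ} (hg : Continuous g) (hg0 : ∀ y, g y ≠ 0) {u v : ℝ}
    (h : ∫ s in u..v, g s = 0) : u = v := by
  obtain ⟨ξ, _, hξ⟩ := exists_integral_eq_mul hg u v
  rw [hξ] at h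
  rcases mul_eq_zero.1 h with h | h
  · exact absurd h (hg0 ξ)
  · linarith

lemma continuous_integral_right {g : ℝ → ℝ} (hg : Continuous g) (u : ℝ) :
    Continuous fun t => ∫ s in u..t, g s :=
  intervalIntegral.continuous_primitive (fun a b => hg.intervalIntegrable a b) u

lemma HasConstantSign.ne_zero {g : ℝ → ℝ} (hg : HasConstantSign g) (y : ℝ) : g y ≠ 0 := by
  rcases hg with h | h
  · exact (h y).ne'
  · exact (h y).ne

lemma HasConstantSign.div_pos {g : ℝ → ℝ} (hg : HasConstantSign g) (y s : ℝ) :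
    0 < g s / g y := by
  rcases hg with h | h
  · exact _root_.div_pos (h s) (h y)
  · exact div_pos_of_neg_of_neg (h s) (h y)

/-- `Y` is an exact root for the interpolant in the bracket, so its residual for `g` is the
integrated interpolation error `E`. Dividing by a lower bound for `|g|` turns this residual into a
distance from the true solution value. -/
lemma bisect_interpolant_spec {r : ℕ} (hr : 1 ≤ r) {f g : ℝ → ℝ} (hg : ContDiff ℝ r g)
    (hgs : HasConstantSign g) (hf : ∀ y, f y = 1 / g y) {y yBar h Λ ρ θ : ℝ} (l : ℕ)
    (hh : 0 < h) (hyBar : yBar = y + 2 * f y * h) (hΛ : 0 < Λ) (hΛ' : Λ ≤ 3 / 2)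
    (hgc : NearlyConstant g Λ ρ y) (hD : NearlyConstant (iteratedDeriv r g) Λ ρ y)
    (hρ : |yBar - y| ≤ ρ) (hθ : θ ∈ Set.Icc (0 : ℝ) 1) {E : ℝ}
    (hE : E = Λ * |iteratedDeriv r g y| / r.factorial * |yBar - y| ^ (r + 1)) (hEh : E ≤ h / 4)
    {I : ℝ × ℝ}
    (hI : I = bisect (fun t => ∫ s in y..t, (nodeInterpolant f r y yBar).eval s) h l y yBar) :
    ∃ Y, |I.1 + θ * (I.2 - I.1) - Y| ≤ |yBar - y| / 2 ^ l ∧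
      |(∫ s in y..Y, g s) - h| ≤ E ∧
      |∫ s in Y..(I.1 + θ * (I.2 - I.1)), g s| ≤ Λ * |g y| * (|yBar - y| / 2 ^ l) ∧
      ∀ w, ∫ s in y..w, g s = h → |Y - w| ≤ Λ * |f y| * E := by
  have hg0 := hgs.ne_zero
  have hgcont := hg.continuous
  have hfg : ∀ y, 1 / f y = g y := fun y => by rw [hf, one_div_one_div]
  have hfy : f y ≠ 0 := by rw [hf]; exact one_div_ne_zero (hg0 y)
  have hne : y ≠ yBar := by
    intro h'
    have : 2 * f y * h = 0 := by linarith
    simp [hfy, hh.ne'] at this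
  have hnear : ∀ s ∈ Set.uIcc y yBar, |s - y| ≤ ρ := fun s hs =>
    (abs_sub_le_of_mem_uIcc hs).trans hρ
  set P := nodeInterpolant f r y yBar with hP
  have herr : ∀ s ∈ Set.uIcc y yBar,
      |g s - P.eval s| ≤ Λ * |iteratedDeriv r g y| / r.factorial * |yBar - y| ^ r := by
    intro s hs
    have hinj : Function.Injective (fun j : Fin r => node y yBar (r - 1) j) :=
      node_injective hne (by omega)
    have := abs_sub_interpolate_le hg (p := fun j : Fin r => node y yBar (r - 1) j) hinj
      (fun j => node_mem_uIcc _ _ (by omega)) (fun ξ hξ => (hD ξ (hnear ξ hξ)).1) hs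
    simpa only [hP, nodeInterpolant, hfg] using this
  have hPc : Continuous fun s => P.eval s := P.continuous
  have hint : ∀ t ∈ Set.uIcc y yBar,
      |(∫ s in y..t, g s) - ∫ s in y..t, P.eval s| ≤ E := by
    intro t ht
    rw [← intervalIntegral.integral_sub (hgcont.intervalIntegrable _ _)
      (hPc.intervalIntegrable _ _), hE, pow_succ, ← mul_assoc, ← Real.norm_eq_abs]
    refine (intervalIntegral.norm_integral_le_of_norm_le_const
      (C := Λ * |iteratedDeriv r g y| / r.factorial * |yBar - y| ^ r) ?_).trans ?_
    · intro s hs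
      exact herr s (Set.uIcc_subset_uIcc Set.left_mem_uIcc ht (Set.uIoc_subset_uIcc hs))
    · exact mul_le_mul_of_nonneg_left (abs_sub_le_of_mem_uIcc ht) (by positivity)
  have hE0 : 0 ≤ E := by rw [hE]; positivity
  -- The bracket is twice the Euler step, and `Λ ≤ 3/2` leaves at least `2 * (2/3) * h`. Subtracting
  -- `E ≤ h/4` still exceeds `h`, so the bracket is valid for the interpolant too.
  have hfull : 4 / 3 * h ≤ ∫ s in y..yBar, g s := by
    obtain ⟨ξ, hξ, hξe⟩ := exists_integral_eq_mul hgcont y yBar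
    have h2 := (hgc ξ (hnear ξ hξ)).2
    have h3 : g ξ * (yBar - y) = 2 * (g ξ / g y) * h := by rw [hyBar, hf]; ring
    have h4 : 2 / 3 ≤ g ξ / g y := by
      rw [← abs_of_pos (hgs.div_pos y ξ), abs_div, le_div_iff₀ (abs_pos.2 (hg0 y))]
      nlinarith [abs_nonneg (g ξ)]
    rw [hξe, h3]
    nlinarith
  obtain ⟨Y, hY, hYh, hmem, hdist⟩ := exists_root_near_bisect
    (F := fun t => ∫ s in y..t, P.eval s) (continuous_integral_right hPc y) l (u := y) (v := yBar)
    (h := h) (by simpa using hh)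
    (by
      have := (abs_le.1 (hint yBar Set.right_mem_uIcc)).2
      linarith) hθ
  rw [← hI] at hmem hdist
  have hYE : |(∫ s in y..Y, g s) - h| ≤ E := by
    have := hint Y hY
    rwa [hYh] at this
  refine ⟨Y, hdist, hYE, ?_, ?_⟩
  · obtain ⟨ξ, hξ, hξe⟩ := exists_integral_eq_mul hgcont Y (I.1 + θ * (I.2 - I.1))
    rw [hξe, abs_mul]
    have := (hgc ξ (hnear ξ (Set.uIcc_subset_uIcc hY hmem hξ))).1
    gcongr
  · intro w hw
    obtain ⟨w', hw', hw'h⟩ := intermediate_value_uIcc (a := y) (b := yBar)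
      (continuous_integral_right hgcont y).continuousOn
      (show h ∈ _ from Set.mem_uIcc.2 (Or.inl ⟨by simpa using hh.le, by linarith⟩))
    replace hw'h : ∫ s in y..w', g s = h := hw'h
    have hii : ∀ a b, IntervalIntegrable g MeasureTheory.volume a b := fun a b =>
      hgcont.intervalIntegrable a b
    -- `w` is not assumed to lie in the bracket; the root there must equal it because `g` keeps its
    -- sign.
    have hww : w' = w := by
      apply eq_of_integral_eq_zero hgcont hg0
      rw [← intervalIntegral.integral_interval_sub_left (hii y w) (hii y w'), hw]
      rw [hw'h, sub_self]
    rw [← hww]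
    obtain ⟨ξ, hξ, hξe⟩ := exists_integral_eq_mul hgcont w' Y
    have h1 : |g ξ * (Y - w')| ≤ E := by
      rw [← hξe, ← intervalIntegral.integral_interval_sub_left (hii y Y) (hii y w')]
      rwa [hw'h]
    rw [abs_mul] at h1
    have h2 := (hgc ξ (hnear ξ (Set.uIcc_subset_uIcc hw' hY hξ))).2
    have hgy := abs_pos.2 (hg0 y)
    rw [hf, abs_div, abs_one, mul_one_div, div_mul_eq_mul_div, le_div_iff₀ hgy]
    calc |Y - w'| * |g y| ≤ |Y - w'| * (Λ * |g ξ|) := by gcongr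
      _ = Λ * (|g ξ| * |Y - w'|) := by ring
      _ ≤ Λ * E := by gcongr

lemma exists_pos_bounds {h : ℝ → ℝ} (hc : Continuous h) (hp : ∀ y, 0 < h y) (A B : ℝ) :
    ∃ m M : ℝ, 0 < m ∧ 0 < M ∧ ∀ y ∈ Set.Icc A B, m ≤ h y ∧ h y ≤ M := by
  rcases (Set.Icc A B).eq_empty_or_nonempty with he | hne
  · exact ⟨1, 1, one_pos, one_pos, by simp [he]⟩
  · obtain ⟨u, _, hu⟩ := isCompact_Icc.exists_isMinOn hne hc.continuousOn
    obtain ⟨v, _, hv⟩ := isCompact_Icc.exists_isMaxOn hne hc.continuousOn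
    exact ⟨h u, h v, hp u, hp v, fun y hy => ⟨hu hy, hv hy⟩⟩

/-- `log |h|` is uniformly continuous on a compact interval with margin `1`; a difference of at most
`log Λ` is a ratio of at most `Λ`. -/
lemma exists_nearlyConstant {h : ℝ → ℝ} (hc : Continuous h) (h0 : ∀ y, h y ≠ 0) (A B : ℝ) {Λ : ℝ}
    (hΛ : 1 < Λ) : ∃ ρ > 0, ∀ y ∈ Set.Icc A B, NearlyConstant h Λ ρ y := by
  have hlog : Continuous fun y => Real.log |h y| :=
    hc.abs.log fun y => abs_ne_zero.2 (h0 y)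
  have hu := isCompact_Icc.uniformContinuousOn_of_continuous
    (s := Set.Icc (A - 1) (B + 1)) hlog.continuousOn
  obtain ⟨δ, hδ, H⟩ := Metric.uniformContinuousOn_iff_le.1 hu (Real.log Λ) (Real.log_pos hΛ)
  refine ⟨min δ 1, lt_min hδ one_pos, fun y hy s hs => ?_⟩
  have hs1 := abs_le.1 (hs.trans (min_le_right _ _))
  have hdist := H s ⟨by linarith [hy.1], by linarith [hy.2]⟩ y
    ⟨by linarith [hy.1], by linarith [hy.2]⟩ (hs.trans (min_le_left _ _))
  rw [Real.dist_eq, abs_le] at hdist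
  have hΛ0 : 0 < Λ := by linarith
  have hys := abs_pos.2 (h0 y)
  have hss := abs_pos.2 (h0 s)
  constructor
  · rw [← Real.log_le_log_iff hss (by positivity), Real.log_mul hΛ0.ne' hys.ne']
    linarith
  · rw [← Real.log_le_log_iff hys (by positivity), Real.log_mul hΛ0.ne' hss.ne']
    linarith

lemma NearlyConstant.mono {h : ℝ → ℝ} {Λ ρ ρ' y : ℝ} (hh : NearlyConstant h Λ ρ y)
    (hρ : ρ' ≤ ρ) : NearlyConstant h Λ ρ' y := fun s hs => hh s (hs.trans hρ)

lemma continuous_density {r : ℕ} {g : ℝ → ℝ} (hg : ContDiff ℝ r g) (hg0 : ∀ y, g y ≠ 0) :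
    Continuous (density r g) := by
  have hD : Continuous (iteratedDeriv r g) := hg.continuous_iteratedDeriv' r
  exact hD.abs.div (hg.continuous.abs.pow _) fun y => pow_ne_zero _ (abs_ne_zero.2 (hg0 y))

/-- What a pass from `(x, y)` achieves, where `H` is the uncut length of the pass. -/
def PassEstimates (f g : ℝ → ℝ) (r : ℕ) (α ε κ Λ y H : ℝ) : Prop :=
  ∀ x b θ : ℝ, x < b → θ ∈ Set.Icc (0 : ℝ) 1 → ∀ p' : ℝ × ℝ, p' = (step r α b ε θ (x, y)).value f →
    p'.1 = min b (x + H) ∧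
    (∀ w, ∫ s in y..w, g s = p'.1 - x →
      |p'.2 - w| ≤ (Λ ^ 3 / (1 - α) * (2 ^ (r + 1) / |constC r|) + 1 / 2) * ε) ∧
    (p'.1 < b → |(∫ s in y..p'.2, g s) - H| ≤ κ * H)

-- With `q = ε^(1/(r+1))`, compactness gives `β * q ≤ H ≤ γ * q` uniformly in `y`. The residual of
-- interpolation is `O(h^(r+1))` and that of bisection `O(ε)`, both of smaller order than `q`, so
-- for small `q` each is at most `κ/2` times the step.
set_option maxHeartbeats 1000000 in
theorem exists_passEstimates {r : ℕ} (hr : 1 ≤ r) {f g : ℝ → ℝ} (hg : ContDiff ℝ r g)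
    (hgs : HasConstantSign g) (hDs : HasConstantSign (iteratedDeriv r g))
    (hf : ∀ y, f y = 1 / g y) {A B Λ α κ ρ : ℝ} (hα : α < 1) (hκ : 0 < κ) (hκ' : κ ≤ 1 / 2)
    (hΛ : 1 ≤ Λ) (hΛ' : Λ ≤ 3 / 2) (hρ : 0 < ρ)
    (hgc : ∀ y ∈ Set.Icc A B, NearlyConstant g Λ ρ y)
    (hDc : ∀ y ∈ Set.Icc A B, NearlyConstant (iteratedDeriv r g) Λ ρ y) :
    ∃ q₀ > 0, ∃ β > 0, ∀ ε : ℝ, 0 < ε → ε ^ (1 / ((r : ℝ) + 1)) ≤ q₀ → ∀ y ∈ Set.Icc A B,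
      ∃ H, β * ε ^ (1 / ((r : ℝ) + 1)) ≤ H ∧
        ε ≤ Λ * (density r g y * |constC r| / r.factorial * (1 - α) * H ^ (r + 1)) ∧
        PassEstimates f g r α ε κ Λ y H := by
  have hg0 := hgs.ne_zero
  have hD0 := hDs.ne_zero
  have hDcont : Continuous (iteratedDeriv r g) := hg.continuous_iteratedDeriv' r
  have hC := abs_pos.2 (constC_ne_zero r hr)
  have hα1 : 0 < 1 - α := by linarith
  have hΛ0 : 0 < Λ := by linarith
  have hfac : (0 : ℝ) < r.factorial := by positivity
  obtain ⟨mg, Mg, hmg, hMg, hgb⟩ :=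
    exists_pos_bounds hg.continuous.abs (fun y => abs_pos.2 (hg0 y)) A B
  obtain ⟨mD, MD, hmD, hMD, hDb⟩ :=
    exists_pos_bounds hDcont.abs (fun y => abs_pos.2 (hD0 y)) A B
  have hφpos : ∀ y, 0 < density r g y := fun y =>
    div_pos (abs_pos.2 (hD0 y)) (pow_pos (abs_pos.2 (hg0 y)) _)
  obtain ⟨mφ, Mφ, hmφ, hMφ, hφb⟩ := exists_pos_bounds (continuous_density hg hg0) hφpos A B
  set e : ℝ := 1 / ((r : ℝ) + 1) with he
  have he0 : 0 ≤ e := by positivity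
  set K₀ : ℝ := 2 ^ (r + 1) / r.factorial with hK₀
  have hK₀pos : 0 < K₀ := by positivity
  set β : ℝ := 2 / (|constC r| * (Λ * (K₀ * Mφ)) * (1 - α)) ^ e with hβ
  set γ : ℝ := 2 / (|constC r| * (K₀ * mφ / Λ) * (1 - α)) ^ e with hγ
  have hβ0 : 0 < β := by positivity
  have hγ0 : 0 < γ := by positivity
  set T : ℝ := Λ * MD / r.factorial * (2 / mg) ^ (r + 1) with hT
  have hT0 : 0 < T := by positivity
  -- One summand per smallness condition, each used as `t * q ≤ 1`: they give `q ≤ 1`, `h ≤ 1`, a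
  -- bracket within `ρ`, `E ≤ κ/2 * h`, and a bisection residual of at most `κ/2 * H`.
  set S : ℝ := 1 + γ + 2 / mg * γ / ρ + 2 * T * γ / κ + Λ * Mg / (κ * β) with hS
  have hS1 : 1 ≤ S := by
    have : 0 ≤ γ + 2 / mg * γ / ρ + 2 * T * γ / κ + Λ * Mg / (κ * β) := by positivity
    linarith
  have hSγ : γ ≤ S := by
    have : 0 ≤ 1 + 2 / mg * γ / ρ + 2 * T * γ / κ + Λ * Mg / (κ * β) := by positivity
    linarith
  have hSρ : 2 / mg * γ / ρ ≤ S := by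
    have : 0 ≤ 1 + γ + 2 * T * γ / κ + Λ * Mg / (κ * β) := by positivity
    linarith
  have hST : 2 * T * γ / κ ≤ S := by
    have : 0 ≤ 1 + γ + 2 / mg * γ / ρ + Λ * Mg / (κ * β) := by positivity
    linarith
  have hSβ : Λ * Mg / (κ * β) ≤ S := by
    have : 0 ≤ 1 + γ + 2 / mg * γ / ρ + 2 * T * γ / κ := by positivity
    linarith
  have hS0 : 0 < S := by linarith
  refine ⟨min ρ (1 / S), lt_min hρ (by positivity), β, hβ0, fun ε hε hq y hy => ?_⟩
  set q := ε ^ e with hqdef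
  have hq0 : 0 < q := Real.rpow_pos_of_pos hε _
  have hqρ : q ≤ ρ := hq.trans (min_le_left _ _)
  have hSq : S * q ≤ 1 := by
    have := hq.trans (min_le_right _ _)
    rwa [le_div_iff₀ hS0, mul_comm] at this
  have hqbound : ∀ {t : ℝ}, t ≤ S → t * q ≤ 1 := fun ht =>
    (mul_le_mul_of_nonneg_right ht hq0.le).trans hSq
  have hqpow : q ^ (r + 1) = ε := rpow_one_div_succ_pow r hε.le
  have hq1 : q ≤ 1 := by simpa using hqbound hS1
  obtain ⟨hc1, hc2⟩ := errorCoeff_bounds hg hg0 hf hε (hDc y hy) hqρ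
  rw [← hK₀] at hc1 hc2
  set c := errorCoeff f r ε y with hcdef
  have hφy := hφpos y
  obtain ⟨hφ1, hφ2⟩ := hφb y hy
  obtain ⟨hg1, hg2⟩ := hgb y hy
  obtain ⟨hD1, hD2⟩ := hDb y hy
  have hc0 : 0 < c := pos_of_mul_pos_right (lt_of_lt_of_le (by positivity) hc1) hΛ0.le
  have hcM : c ≤ Λ * (K₀ * Mφ) := hc2.trans (by gcongr)
  have hcm : K₀ * mφ / Λ ≤ c := by
    rw [div_le_iff₀ hΛ0, mul_comm c]
    exact (by gcongr : K₀ * mφ ≤ K₀ * density r g y).trans hc1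
  set H := passLength f r α ε y with hH
  have hH0 : 0 < H := passLength_pos hr hε hα hc0
  have hHβ : β * q ≤ H := by
    rw [hH, passLength, ← he, ← hqdef, ← hcdef, hβ]
    gcongr
  have hHγ : H ≤ γ * q := by
    rw [hH, passLength, ← he, ← hqdef, ← hcdef, hγ]
    gcongr
  have hHpow : density r g y * |constC r| / r.factorial * (1 - α) * H ^ (r + 1)
      = K₀ * density r g y * ε / c := by
    rw [hH, passLength_pow hε.le hα.le hc0.le, ← hcdef, hK₀]
    field_simp
  have hfy : |f y| = 1 / |g y| := by rw [hf, abs_div, abs_one]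
  have hgy : 0 < |g y| := abs_pos.2 (hg0 y)
  have hfy1 : |f y| ≤ 1 / mg := by rw [hfy]; gcongr
  refine ⟨H, hHβ, ?_, ?_⟩
  · rw [hHpow, mul_div_assoc', le_div_iff₀ hc0]
    calc ε * c ≤ ε * (Λ * (K₀ * density r g y)) := by gcongr
      _ = _ := by ring
  intro x b θ hxb hθ p' hp'
  rw [step_value f r α b ε θ x y rfl rfl rfl] at hp'
  set x' := min b (x + passLength f r α ε y) with hx'
  set h := x' - x with hh
  set yBar := y + 2 * f y * h with hyBar
  set l := bisecSteps r α ε (f y) (errorCoeff f r ε y) with hl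
  set I := bisect (fun t => ∫ s in y..t, (nodeInterpolant f r y yBar).eval s) h l y yBar with hI
  have hh0 : 0 < h := by
    rw [hh, sub_pos, hx']
    exact lt_min hxb (by linarith)
  have hhH : h ≤ H := by
    have : x' ≤ x + H := min_le_right _ _
    linarith
  have hlen : |yBar - y| = 2 * |f y| * h := by
    rw [hyBar, add_sub_cancel_left, abs_mul, abs_mul, abs_two, abs_of_pos hh0]
  have hhq : h ≤ γ * q := hhH.trans hHγ
  have hlenρ : |yBar - y| ≤ ρ := by
    have h1 := hqbound hSρ
    rw [div_mul_eq_mul_div, div_le_one hρ] at h1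
    calc |yBar - y| ≤ 2 * (1 / mg) * (γ * q) := by rw [hlen]; gcongr
      _ = 2 / mg * γ * q := by ring
      _ ≤ ρ := h1
  set E := Λ * |iteratedDeriv r g y| / r.factorial * |yBar - y| ^ (r + 1) with hE
  have hE0 : 0 ≤ E := by positivity
  have hEκ : E ≤ κ / 2 * h := by
    have h1 := hqbound hST
    rw [div_mul_eq_mul_div, div_le_one hκ] at h1
    have hh1 : h ≤ 1 := hhq.trans (hqbound hSγ)
    have hhr : h ^ r ≤ h := pow_le_of_le_one hh0.le hh1 (by omega)
    calc E = Λ * |iteratedDeriv r g y| / r.factorial * (2 * |f y|) ^ (r + 1) * (h ^ r * h) := by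
          rw [hE, hlen, mul_pow, ← pow_succ]; ring
      _ ≤ Λ * MD / r.factorial * (2 * (1 / mg)) ^ (r + 1) * (γ * q * h) := by
          gcongr
          exact hhr.trans hhq
      _ = (T * γ * q) * h := by rw [hT, mul_one_div]; ring
      _ ≤ κ / 2 * h := by
          gcongr
          linarith
  have hEh : E ≤ h / 4 := by
    have := mul_le_mul_of_nonneg_right hκ' hh0.le
    linarith
  obtain ⟨Y, hY1, hY2, hY3, hY4⟩ := bisect_interpolant_spec hr hg hgs hf l hh0 hyBar hΛ0 hΛ'
    (hgc y hy) (hDc y hy) hlenρ hθ hE hEh hI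
  have hsteps := two_pow_bisecSteps (f := f) (r := r) (y := y) hε hα hc0.le
  have hbis : |yBar - y| / 2 ^ l ≤ ε / 2 := by
    rw [hlen, div_le_iff₀ (by positivity)]
    have : 4 * |f y| * h ≤ 4 * |f y| * H := by gcongr
    linarith
  subst hp'
  refine ⟨rfl, ?_, ?_⟩
  · intro w hw
    have hw' := hY4 w hw
    -- The three factors `Λ` come from converting the residual to a distance, from the derivative
    -- bound in `E`, and from `ĉ`.
    have hfE : Λ * |f y| * E ≤ Λ ^ 3 / (1 - α) * (2 ^ (r + 1) / |constC r|) * ε := by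
      have h1 : Λ * |f y| * E = Λ ^ 2 * (K₀ * density r g y) * h ^ (r + 1) := by
        rw [hE, hlen, hfy, density, hK₀, mul_pow, mul_pow, one_div, inv_pow]
        field_simp
        ring
      have h2 : Λ ^ 2 * (K₀ * density r g y) * H ^ (r + 1)
          = Λ ^ 2 / (1 - α) * (2 ^ (r + 1) / |constC r|)
            * (density r g y * |constC r| / r.factorial * (1 - α) * H ^ (r + 1)) := by
        rw [hK₀]
        field_simp
      have h3 : K₀ * density r g y * ε / c ≤ Λ * ε := by
        rw [div_le_iff₀ hc0]
        calc K₀ * density r g y * ε ≤ Λ * c * ε := by gcongr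
          _ = _ := by ring
      calc Λ * |f y| * E ≤ Λ ^ 2 * (K₀ * density r g y) * H ^ (r + 1) := by rw [h1]; gcongr
        _ ≤ Λ ^ 2 / (1 - α) * (2 ^ (r + 1) / |constC r|) * (Λ * ε) := by
          rw [h2, hHpow]; gcongr
        _ = _ := by ring
    calc _ ≤ |I.1 + θ * (I.2 - I.1) - Y| + |Y - w| := abs_sub_le _ _ _
      _ ≤ ε / 2 + Λ ^ 3 / (1 - α) * (2 ^ (r + 1) / |constC r|) * ε :=
          add_le_add (hY1.trans hbis) (hw'.trans hfE)
      _ = _ := by ring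
  · intro hlt
    have hhH' : h = H := by
      have : x' = x + H := min_eq_right (by
        by_contra hcon
        have : x' = b := min_eq_left (not_le.1 hcon).le
        exact hlt.ne this)
      rw [hh, this, add_sub_cancel_left]
    have hii : ∀ a b, IntervalIntegrable g MeasureTheory.volume a b := fun a b =>
      hg.continuous.intervalIntegrable a b
    have h1 := hqbound hSβ
    rw [div_mul_eq_mul_div, div_le_one (by positivity)] at h1
    have hεq : ε ≤ q * q := by
      rw [← hqpow, pow_succ]
      gcongr
      exact pow_le_of_le_one hq0.le hq1 (by omega)
    have hthird : Λ * |g y| * (|yBar - y| / 2 ^ l) ≤ κ / 2 * H := by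
      calc Λ * |g y| * (|yBar - y| / 2 ^ l) ≤ Λ * Mg * ((q * q) / 2) :=
            mul_le_mul (mul_le_mul_of_nonneg_left hg2 hΛ0.le)
              (hbis.trans (by linarith)) (by positivity) (by positivity)
        _ = (Λ * Mg * q) * q / 2 := by ring
        _ ≤ (κ * β) * q / 2 := by
            have := mul_le_mul_of_nonneg_right h1 hq0.le
            linarith
        _ = κ / 2 * (β * q) := by ring
        _ ≤ κ / 2 * H := by gcongr
    simp only
    rw [← intervalIntegral.integral_add_adjacent_intervals (hii y Y) (hii Y _), ← hhH']
    rw [← hhH'] at hthird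
    calc _ = |((∫ s in y..Y, g s) - h) + ∫ s in Y..(I.1 + θ * (I.2 - I.1)), g s| := by
          congr 1; ring
      _ ≤ E + Λ * |g y| * (|yBar - y| / 2 ^ l) := (abs_add_le _ _).trans (add_le_add hY2 hY3)
      _ ≤ κ / 2 * h + κ / 2 * h := add_le_add hEκ hthird
      _ = κ * h := by ring

/-! ### The separated equation along solutions -/

lemma integral_along_integralCurve {f g : ℝ → ℝ} (hg : Continuous g) (hg0 : ∀ y, g y ≠ 0)
    (hf : ∀ y, f y = 1 / g y) {z : ℝ → ℝ} {a b : ℝ}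
    (hz : IsIntegralCurveOn z (fun _ => f) (Set.Icc a b)) {s t : ℝ} (hs : s ∈ Set.Icc a b)
    (ht : t ∈ Set.Icc a b) : ∫ u in z s..z t, g u = t - s := by
  have hG : ∀ x, HasDerivAt (fun t => ∫ u in z s..t, g u) (g x) x := fun x =>
    intervalIntegral.integral_hasDerivAt_right (hg.intervalIntegrable _ _)
      (hg.stronglyMeasurableAtFilter _ _) hg.continuousAt
  have hd : ∀ τ ∈ Set.Icc a b, HasDerivWithinAt (fun τ => (∫ u in z s..z τ, g u) - τ) 0
      (Set.Icc a b) τ := by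
    intro τ hτ
    have h1 := ((hG (z τ)).comp_hasDerivWithinAt τ (hz τ hτ)).sub (hasDerivWithinAt_id τ _)
    have e : g (z τ) * (fun _ => f) τ (z τ) - 1 = 0 := by
      simp only [hf, mul_one_div_cancel (hg0 _), sub_self]
    rw [e] at h1
    exact h1
  have h := (convex_Icc a b).norm_image_sub_le_of_norm_hasDerivWithin_le (C := 0) hd
    (fun τ _ => by simp) hs ht
  rw [zero_mul] at h
  have h2 := sub_eq_zero.1 (norm_le_zero_iff.1 h)
  simp only [intervalIntegral.integral_same] at h2
  linarith

/-- The lower bound on `|g|` is known only near `z`. If `y` were farther than `ρ`, the stretch up to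
distance `ρ` would already contribute `m * ρ`, and the rest cannot cancel it because `g` has
constant sign. -/
lemma abs_sub_le_of_abs_integral_lt {g : ℝ → ℝ} (hg : Continuous g) (hgs : HasConstantSign g)
    {z y m ρ : ℝ} (hρ : 0 < ρ) (hm : ∀ s, |s - z| ≤ ρ → m ≤ |g s|)
    (h : |∫ s in z..y, g s| < m * ρ) : |y - z| ≤ ρ := by
  by_contra hlt
  push Not at hlt
  have hyz : 0 < |y - z| := hρ.trans hlt
  set t := ρ / |y - z| with ht
  have ht0 : 0 < t := div_pos hρ hyz
  have ht1 : t ≤ 1 := (div_le_one hyz).2 hlt.le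
  have htρ : t * |y - z| = ρ := div_mul_cancel₀ _ hyz.ne'
  set u := z + t * (y - z) with hu
  have huz : |u - z| = ρ := by
    rw [hu, add_sub_cancel_left, abs_mul, abs_of_pos ht0, htρ]
  obtain ⟨ξ₁, hξ₁, h1⟩ := exists_integral_eq_mul hg z u
  obtain ⟨ξ₂, -, h2⟩ := exists_integral_eq_mul hg u y
  have hsum : ∫ s in z..y, g s = (g ξ₁ * t + g ξ₂ * (1 - t)) * (y - z) := by
    rw [← intervalIntegral.integral_add_adjacent_intervals (hg.intervalIntegrable z u)
      (hg.intervalIntegrable u y), h1, h2, hu]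
    ring
  have hpos : 0 ≤ g ξ₁ * t * (g ξ₂ * (1 - t)) := by
    have h3 : 0 < g ξ₁ * g ξ₂ := by
      rcases hgs with h | h
      · exact mul_pos (h _) (h _)
      · exact mul_pos_of_neg_of_neg (h _) (h _)
    have h4 : 0 ≤ t * (1 - t) := mul_nonneg ht0.le (by linarith)
    calc 0 ≤ (g ξ₁ * g ξ₂) * (t * (1 - t)) := mul_nonneg h3.le h4
      _ = _ := by ring
  have habs : |g ξ₁| * t ≤ |g ξ₁ * t + g ξ₂ * (1 - t)| := by
    have h3 : |g ξ₁| * t = |g ξ₁ * t| := by rw [abs_mul, abs_of_pos ht0]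
    rw [h3]
    apply sq_le_sq.1
    nlinarith [sq_nonneg (g ξ₂ * (1 - t))]
  have hfin : m * ρ ≤ |∫ s in z..y, g s| := by
    rw [hsum, abs_mul]
    calc m * ρ ≤ |g ξ₁| * ρ := by
          gcongr
          exact hm ξ₁ (huz ▸ abs_sub_le_of_mem_uIcc hξ₁)
      _ = |g ξ₁| * t * |y - z| := by rw [mul_assoc, htρ]
      _ ≤ _ := by gcongr
  linarith

/-- The primitive of `g` takes the value `t - s` somewhere between `z s` and `z w`; being injective,
it does so only at `z t`. -/
lemma integralCurve_mem_uIcc {f g : ℝ → ℝ} (hg : Continuous g) (hg0 : ∀ y, g y ≠ 0)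
    (hf : ∀ y, f y = 1 / g y) {z : ℝ → ℝ} {a b : ℝ}
    (hz : IsIntegralCurveOn z (fun _ => f) (Set.Icc a b)) {s t w : ℝ} (hs : a ≤ s) (hst : s ≤ t)
    (htw : t ≤ w) (hw : w ≤ b) : z t ∈ Set.uIcc (z s) (z w) := by
  have hs' : s ∈ Set.Icc a b := ⟨hs, by linarith⟩
  have hsw := integral_along_integralCurve hg hg0 hf hz hs' (t := w) ⟨by linarith, hw⟩
  have hst' := integral_along_integralCurve hg hg0 hf hz hs' (t := t) ⟨by linarith, by linarith⟩
  obtain ⟨v, hv, hvt⟩ := intermediate_value_uIcc (a := z s) (b := z w)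
    (continuous_integral_right hg (z s)).continuousOn
    (show t - s ∈ _ from Set.mem_uIcc.2 (Or.inl ⟨by simpa using hst, by linarith⟩))
  replace hvt : ∫ u in z s..v, g u = t - s := hvt
  have : v = z t := by
    apply eq_of_integral_eq_zero hg hg0
    rw [← intervalIntegral.integral_interval_sub_left (hg.intervalIntegrable (z s) (z t))
      (hg.intervalIntegrable (z s) v), hst', hvt, sub_self]
  exact this ▸ hv

/-! ### The reference quantities and their lower bound -/

lemma density_nonneg (r : ℕ) (g : ℝ → ℝ) (y : ℝ) : 0 ≤ density r g y := by
  unfold density; positivity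

lemma localErr_nonneg (r : ℕ) (g z : ℝ → ℝ) {s t : ℝ} (hst : s ≤ t) :
    0 ≤ localErr r g z s t := by
  have h1 : 0 ≤ sSup ((fun y => |iteratedDeriv r g y| / |g y| ^ (r + 2)) ''
      Set.uIcc (z s) (z t)) := by
    apply Real.sSup_nonneg
    rintro _ ⟨y, -, rfl⟩
    exact density_nonneg r g y
  have h2 : 0 ≤ t - s := by linarith
  unfold localErr
  positivity

lemma le_localErr {r : ℕ} {g : ℝ → ℝ} (hg : ContDiff ℝ r g) (hg0 : ∀ y, g y ≠ 0) {z : ℝ → ℝ}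
    {s t y : ℝ} (hst : s ≤ t) (hy : y ∈ Set.uIcc (z s) (z t)) :
    density r g y * |constC r| / r.factorial * (t - s) ^ (r + 1) ≤ localErr r g z s t := by
  have h2 : 0 ≤ t - s := by linarith
  have hb : BddAbove (density r g '' Set.uIcc (z s) (z t)) :=
    isCompact_uIcc.bddAbove_image (continuous_density hg hg0).continuousOn
  have h1 : density r g y ≤ sSup (density r g '' Set.uIcc (z s) (z t)) :=
    le_csSup hb ⟨y, hy, rfl⟩
  change _ ≤ sSup (density r g '' Set.uIcc (z s) (z t)) * |constC r| / r.factorial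
    * (t - s) ^ (r + 1)
  gcongr

lemma localErr_le {r : ℕ} {g z : ℝ → ℝ} {s t M : ℝ} (hst : s ≤ t)
    (hM : ∀ y ∈ Set.uIcc (z s) (z t), density r g y ≤ M) :
    localErr r g z s t ≤ M * |constC r| / r.factorial * (t - s) ^ (r + 1) := by
  have h2 : 0 ≤ t - s := by linarith
  have h1 : sSup (density r g '' Set.uIcc (z s) (z t)) ≤ M := by
    apply csSup_le (Set.nonempty_uIcc.image _)
    rintro _ ⟨y, hy, rfl⟩
    exact hM y hy
  change sSup (density r g '' Set.uIcc (z s) (z t)) * |constC r| / r.factorial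
    * (t - s) ^ (r + 1) ≤ _
  gcongr

/-- The mesh of `m` intervals of equal length. -/
noncomputable def uniformMesh (a b : ℝ) (m : ℕ) (i : Fin (m + 1)) : ℝ :=
  a + (b - a) * ((i : ℕ) / (m : ℝ))

lemma uniformMesh_monotone {a b : ℝ} (hab : a ≤ b) (m : ℕ) : Monotone (uniformMesh a b m) := by
  intro i j hij
  have h : 0 ≤ b - a := by linarith
  have h2 : ((i : ℕ) : ℝ) ≤ (j : ℕ) := by exact_mod_cast hij
  unfold uniformMesh
  gcongr

lemma uniformMesh_zero (a b : ℝ) (m : ℕ) : uniformMesh a b m 0 = a := by simp [uniformMesh]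

lemma uniformMesh_last (a b : ℝ) {m : ℕ} (hm : 1 ≤ m) : uniformMesh a b m (Fin.last m) = b := by
  have : (m : ℝ) ≠ 0 := by exact_mod_cast (by omega : m ≠ 0)
  simp [uniformMesh, div_self this]

/-- On a uniform mesh every local error is at most `K / m^(r+1) ≤ K / m`. This ensures that `mOf` is
an attained minimum rather than the default `0`. -/
lemma exists_kStar_le {r : ℕ} {g z : ℝ → ℝ} {a b A B M ε : ℝ} (hab : a ≤ b) (hε : 0 < ε)
    (hM : ∀ y ∈ Set.Icc A B, density r g y ≤ M) (hz : ∀ t ∈ Set.Icc a b, z t ∈ Set.Icc A B) :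
    ∃ m, 1 ≤ m ∧ kStar r g z a b m ≤ ε := by
  have hM0 : 0 ≤ M := (density_nonneg r g _).trans (hM _ (hz a ⟨le_rfl, hab⟩))
  have hba : 0 ≤ b - a := by linarith
  set K := M * |constC r| / r.factorial * (b - a) ^ (r + 1) with hK
  have hK0 : 0 ≤ K := by positivity
  obtain ⟨n, hn⟩ := exists_nat_ge (K / ε)
  set m := n + 1 with hm
  have hm1 : 1 ≤ m := by omega
  have hmpos : (0 : ℝ) < m := by exact_mod_cast hm1
  have hmono := uniformMesh_monotone hab m
  have hmem : ∀ i, uniformMesh a b m i ∈ Set.Icc a b := fun i =>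
    ⟨(uniformMesh_zero a b m).symm.le.trans (hmono (Fin.zero_le i)),
      (hmono (Fin.le_last i)).trans (uniformMesh_last a b hm1).le⟩
  have hbdd : BddBelow {k : ℝ | ∃ x : Fin (m + 1) → ℝ, Monotone x ∧ x 0 = a ∧ x (Fin.last m) = b ∧
      k = ⨆ i : Fin m, localErr r g z (x i.castSucc) (x i.succ)} := by
    refine ⟨0, ?_⟩
    rintro k ⟨x, hx, -, -, rfl⟩
    exact Real.iSup_nonneg fun i => localErr_nonneg r g z (hx Fin.castSucc_lt_succ.le)
  refine ⟨m, hm1, (csInf_le hbdd ⟨uniformMesh a b m, hmono, uniformMesh_zero a b m,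
    uniformMesh_last a b hm1, rfl⟩).trans ?_⟩
  · refine Real.iSup_le (fun i => ?_) hε.le
    have hlen : uniformMesh a b m i.succ - uniformMesh a b m i.castSucc = (b - a) / m := by
      simp only [uniformMesh, Fin.val_succ, Fin.val_castSucc]
      push_cast
      field_simp
      ring
    refine (localErr_le (hmono Fin.castSucc_lt_succ.le)
      fun y hy => hM y (Set.ordConnected_Icc.uIcc_subset (hz _ (hmem _)) (hz _ (hmem _)) hy)).trans
      ?_
    have hmp : (m : ℝ) ≤ m ^ (r + 1) :=
      le_self_pow₀ (by exact_mod_cast hm1) (Nat.succ_ne_zero r)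
    rw [hlen, div_pow, mul_div_assoc', ← hK, div_le_iff₀ (by positivity)]
    rw [div_le_iff₀ hε] at hn
    calc K ≤ n * ε := hn
      _ ≤ m * ε := by rw [hm]; push_cast; gcongr; linarith
      _ ≤ m ^ (r + 1) * ε := by gcongr
      _ = _ := by ring

/-- A mesh that lags behind the points `X 0, …, X m` has an interval that contains one of theirs. -/
lemma exists_interval_subset {m : ℕ} {x : Fin (m + 1) → ℝ} {X : ℕ → ℝ} (h0 : x 0 ≤ X 0)
    (hlast : X m < x (Fin.last m)) :
    ∃ i : Fin m, x i.castSucc ≤ X i ∧ X (i + 1) < x i.succ := by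
  by_contra hcon
  push Not at hcon
  have : ∀ i : Fin (m + 1), x i ≤ X i := by
    intro i
    induction i using Fin.induction with
    | zero => simpa using h0
    | succ i ih => simpa using hcon i (by simpa using ih)
  have h := this (Fin.last m)
  rw [Fin.val_last] at h
  linarith

/-- Some mesh interval contains `[X i, X (i + 1)]`: its length is no smaller, and its supremum sees
the density at `z (X i)`. -/
lemma le_kStar {r : ℕ} {f g : ℝ → ℝ} (hg : ContDiff ℝ r g) (hg0 : ∀ y, g y ≠ 0)
    (hf : ∀ y, f y = 1 / g y) {z : ℝ → ℝ} {a b : ℝ} (hab : a ≤ b)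
    (hz : IsIntegralCurveOn z (fun _ => f) (Set.Icc a b)) {m : ℕ} (hm : 1 ≤ m) {X : ℕ → ℝ}
    (hX0 : X 0 = a) (hXm : X m < b) {ε' : ℝ}
    (hX : ∀ i < m, X i ≤ X (i + 1) ∧
      ε' ≤ density r g (z (X i)) * |constC r| / r.factorial * (X (i + 1) - X i) ^ (r + 1)) :
    ε' ≤ kStar r g z a b m := by
  refine le_csInf ⟨_, uniformMesh a b m, uniformMesh_monotone hab m, uniformMesh_zero a b m,
    uniformMesh_last a b hm, rfl⟩ ?_
  rintro k ⟨x, hx, hx0, hxm, rfl⟩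
  obtain ⟨i, hi1, hi2⟩ := exists_interval_subset (x := x) (X := X) (by rw [hx0, hX0])
    (by rw [hxm]; exact hXm)
  obtain ⟨hle, hε⟩ := hX i i.2
  have hax : a ≤ x i.castSucc := hx0 ▸ hx (Fin.zero_le _)
  have hxb : x i.succ ≤ b := hxm ▸ hx (Fin.le_last _)
  have hpos : 0 ≤ X (i + 1) - X i := by linarith
  calc ε' ≤ density r g (z (X i)) * |constC r| / r.factorial * (X (i + 1) - X i) ^ (r + 1) := hε
    _ ≤ density r g (z (X i)) * |constC r| / r.factorial
          * (x i.succ - x i.castSucc) ^ (r + 1) := by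
        have := density_nonneg r g (z (X i))
        gcongr
    _ ≤ localErr r g z (x i.castSucc) (x i.succ) :=
        le_localErr hg hg0 (hx Fin.castSucc_lt_succ.le)
          (integralCurve_mem_uIcc hg.continuous hg0 hf hz hax hi1 (by linarith) hxb)
    _ ≤ _ := le_ciSup (f := fun i : Fin m => localErr r g z (x i.castSucc) (x i.succ))
        (Set.finite_range _).bddAbove i

/-- One factor `Λ` comes from the derivative and `r + 2` from the power of `g`. -/
lemma density_le_of_nearlyConstant {r : ℕ} {g : ℝ → ℝ} (hg0 : ∀ y, g y ≠ 0) {Λ ρ y z : ℝ}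
    (hΛ : 0 < Λ) (hgc : NearlyConstant g Λ ρ z) (hDc : NearlyConstant (iteratedDeriv r g) Λ ρ z)
    (hyz : |y - z| ≤ ρ) : density r g y ≤ Λ ^ (r + 3) * density r g z := by
  have h1 := (hDc y hyz).1
  have h2 := (hgc y hyz).2
  have hgy := abs_pos.2 (hg0 y)
  have hgz := abs_pos.2 (hg0 z)
  unfold density
  rw [mul_div_assoc', div_le_div_iff₀ (by positivity) (by positivity)]
  calc |iteratedDeriv r g y| * |g z| ^ (r + 2)
      ≤ (Λ * |iteratedDeriv r g z|) * (Λ * |g y|) ^ (r + 2) := by gcongr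
    _ = _ := by ring

/-! ### The iteration and the main theorem -/

lemma pair_succ (f : ℝ → ℝ) (r : ℕ) (α a b η ε : ℝ) (θ : ℕ → ℝ) (i : ℕ) :
    pair f r α a b η ε θ (i + 1)
      = (step r α b ε (θ i) ((pair f r α a b η ε θ i).1, (pair f r α a b η ε θ i).2)).value f :=
  rfl

/-- Before stopping no pass is cut off, so each advances by its full `H ≥ μ` and adds at most `κ *
H` to the residual. The total stays below `κ * (b - a)`, which keeps the iterate in `K`, where the
pass estimates apply again. -/
lemma pair_invariant {f g : ℝ → ℝ} (hg : Continuous g) {r : ℕ} {α a b η ε κ Λ μ : ℝ} {θ : ℕ → ℝ}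
    (hab : a < b) (hκ : 0 ≤ κ) (hμ : 0 < μ) (hθ : ∀ i, θ i ∈ Set.Icc (0 : ℝ) 1) {K : Set ℝ}
    (hK : ∀ x ∈ Set.Icc a b, ∀ y, |(∫ s in η..y, g s) - (x - a)| ≤ κ * (b - a) → y ∈ K)
    (hstep : ∀ y ∈ K, ∃ H, μ ≤ H ∧ PassEstimates f g r α ε κ Λ y H) (i : ℕ)
    (hi : ∀ j ≤ i, (pair f r α a b η ε θ j).1 ≠ b) :
    a + i * μ ≤ (pair f r α a b η ε θ i).1 ∧ (pair f r α a b η ε θ i).1 < b ∧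
      |(∫ s in η..(pair f r α a b η ε θ i).2, g s) - ((pair f r α a b η ε θ i).1 - a)|
        ≤ κ * ((pair f r α a b η ε θ i).1 - a) := by
  induction i with
  | zero => simp [pair, hab]
  | succ i ih =>
    obtain ⟨h1, h2, h3⟩ := ih fun j hj => hi j (by omega)
    set x := (pair f r α a b η ε θ i).1
    set y := (pair f r α a b η ε θ i).2
    have hne := hi (i + 1) le_rfl
    have hax : a ≤ x := by
      have : 0 ≤ (i : ℝ) * μ := by positivity
      linarith
    have hy : y ∈ K := hK x ⟨hax, h2.le⟩ y (h3.trans (by gcongr))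
    obtain ⟨H, hH, hE⟩ := hstep y hy
    obtain ⟨e1, -, e3⟩ := hE x b (θ i) h2 (hθ i) _ (pair_succ f r α a b η ε θ i)
    set p' := pair f r α a b η ε θ (i + 1)
    have hlt : p'.1 < b := lt_of_le_of_ne (e1 ▸ min_le_left _ _) hne
    have hx' : p'.1 = x + H := by
      rcases min_choice b (x + H) with h | h
      · exact absurd (e1.trans h) hne
      · exact e1.trans h
    have e3' := e3 hlt
    refine ⟨?_, hlt, ?_⟩
    · rw [hx']
      push_cast
      linarith
    · rw [← intervalIntegral.integral_add_adjacent_intervals (hg.intervalIntegrable η y)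
        (hg.intervalIntegrable y _), hx']
      calc _ = |((∫ s in η..y, g s) - (x - a)) + ((∫ s in y..p'.2, g s) - H)| := by
            congr 1; ring
        _ ≤ κ * (x - a) + κ * H := (abs_add_le _ _).trans (add_le_add h3 e3')
        _ = _ := by ring

end ADMESH

open ADMESH in
theorem theorem1 (r : ℕ) (hr : 1 ≤ r) (f : ℝ → ℝ) (hf : f ∈ ADMESH.classF r)
    (a b η : ℝ) (hab : a < b)
    (z : ℝ → ℝ) (hz : IsIntegralCurveOn z (fun _ => f) (Set.Icc a b)) (hza : z a = η)
    (α : ℝ) (hα : α ∈ Set.Ioo (0 : ℝ) (1 / 2)) :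
    ∃ ε₀ : ℝ, 0 < ε₀ ∧ ∀ ε : ℝ, 0 < ε → ε ≤ ε₀ →
      ∀ θ : ℕ → ℝ, (∀ i, θ i ∈ Set.Icc (0 : ℝ) 1) →
        ∃ mHat : ℕ, ADMESH.StopsAfter f r α a b η ε θ mHat ∧
          (∀ i < mHat, ∀ zi : ℝ → ℝ,
            IsIntegralCurveOn zi (fun _ => f)
              (Set.Icc (ADMESH.pair f r α a b η ε θ i).1 (ADMESH.pair f r α a b η ε θ (i + 1)).1) →
            zi (ADMESH.pair f r α a b η ε θ i).1 = (ADMESH.pair f r α a b η ε θ i).2 →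
            |(ADMESH.pair f r α a b η ε θ (i + 1)).2
                - zi (ADMESH.pair f r α a b η ε θ (i + 1)).1|
              ≤ ((1 + α) / (1 - α) * (2 ^ (r + 1) / |ADMESH.constC r|) + 1 / 2) * ε) ∧
          ADMESH.totalCost f r α a b η ε θ mHat
            ≤ 2 * r * ADMESH.mOf r (fun y => 1 / f y) z a b ε := by
  obtain ⟨g, hg, hgs, hDs, hfg, -⟩ := hf
  obtain ⟨hα0, hα2⟩ := hα
  have hg0 := hgs.ne_zero
  have hD0 := hDs.ne_zero
  have hgc := hg.continuous
  have hDc : Continuous (iteratedDeriv r g) := hg.continuous_iteratedDeriv' r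
  have hinv : (fun y => 1 / f y) = g := by
    ext y; rw [hfg, one_div_one_div]
  rw [hinv]
  have hα1 : 0 < 1 - α := by linarith
  -- the tolerance factor
  obtain ⟨Λ, hΛ1, hΛpow⟩ : ∃ Λ : ℝ, 1 < Λ ∧ Λ ^ (r + 4) = 1 + α := by
    refine ⟨(1 + α) ^ (((r + 4 : ℕ) : ℝ)⁻¹), Real.one_lt_rpow (by linarith) (by positivity), ?_⟩
    exact Real.rpow_inv_natCast_pow (by linarith) (by omega)
  have hΛ0 : 0 < Λ := by linarith
  have hΛ2 : Λ ≤ 3 / 2 := by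
    have := le_self_pow₀ hΛ1.le (show r + 4 ≠ 0 by omega)
    linarith
  -- a compact interval around the values of the solution
  have hzc : ContinuousOn z (Set.Icc a b) := fun t ht => (hz t ht).continuousWithinAt
  obtain ⟨A, hA⟩ := isCompact_Icc.bddBelow_image hzc
  obtain ⟨B, hB⟩ := isCompact_Icc.bddAbove_image hzc
  have hzAB : ∀ t ∈ Set.Icc a b, z t ∈ Set.Icc A B := fun t ht =>
    ⟨hA ⟨t, ht, rfl⟩, hB ⟨t, ht, rfl⟩⟩
  obtain ⟨ρ₁, hρ₁, hgρ⟩ := exists_nearlyConstant hgc hg0 (A - 1) (B + 1) hΛ1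
  obtain ⟨ρ₂, hρ₂, hDρ⟩ := exists_nearlyConstant hDc hD0 (A - 1) (B + 1) hΛ1
  obtain ⟨m, _, hm, -, hmb⟩ :=
    exists_pos_bounds hgc.abs (fun y => abs_pos.2 (hg0 y)) (A - 1) (B + 1)
  obtain ⟨_, M, -, -, hMb⟩ :=
    exists_pos_bounds (continuous_density hg hg0)
      (fun y => div_pos (abs_pos.2 (hD0 y)) (pow_pos (abs_pos.2 (hg0 y)) _)) A B
  set ρ := min (min ρ₁ ρ₂) 1 with hρdef
  have hρ : 0 < ρ := lt_min (lt_min hρ₁ hρ₂) one_pos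
  have hρ1 : ρ ≤ 1 := min_le_right _ _
  have hgρ' : ∀ y ∈ Set.Icc (A - 1) (B + 1), NearlyConstant g Λ ρ y := fun y hy =>
    (hgρ y hy).mono ((min_le_left _ _).trans (min_le_left _ _))
  have hDρ' : ∀ y ∈ Set.Icc (A - 1) (B + 1), NearlyConstant (iteratedDeriv r g) Λ ρ y :=
    fun y hy => (hDρ y hy).mono ((min_le_left _ _).trans (min_le_right _ _))
  have hba : 0 < b - a := by linarith
  -- The second entry makes the accumulated residual at most `m * ρ / 2`, so the iterates stay
  -- within `ρ ≤ 1` of `z` and inside the enlarged interval.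
  set κ := min (1 / 2) (m * ρ / (2 * (b - a))) with hκdef
  have hκ : 0 < κ := lt_min (by norm_num) (by positivity)
  have hκb : κ * (b - a) < m * ρ := by
    have h1 : κ * (b - a) ≤ m * ρ / (2 * (b - a)) * (b - a) := by
      gcongr
      exact min_le_right _ _
    have h2 : m * ρ / (2 * (b - a)) * (b - a) = m * ρ / 2 := by field_simp
    have h3 : 0 < m * ρ := by positivity
    linarith
  have hnear : ∀ x ∈ Set.Icc a b, ∀ y, |(∫ s in η..y, g s) - (x - a)| ≤ κ * (b - a) →
      |y - z x| ≤ ρ := by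
    intro x hx y hy
    have hzx := hzAB x hx
    refine abs_sub_le_of_abs_integral_lt hgc hgs hρ (m := m) (fun s hs => (hmb s ?_).1) ?_
    · have := abs_le.1 (hs.trans hρ1)
      exact ⟨by linarith [hzx.1], by linarith [hzx.2]⟩
    · have h1 := integral_along_integralCurve hgc hg0 hfg hz (Set.left_mem_Icc.2 hab.le) hx
      rw [hza] at h1
      rw [← intervalIntegral.integral_interval_sub_left (hgc.intervalIntegrable η y)
        (hgc.intervalIntegrable η (z x)), h1]
      exact hy.trans_lt hκb
  have hK : ∀ x ∈ Set.Icc a b, ∀ y, |(∫ s in η..y, g s) - (x - a)| ≤ κ * (b - a) →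
      y ∈ Set.Icc (A - 1) (B + 1) := by
    intro x hx y hy
    have h1 := abs_le.1 ((hnear x hx y hy).trans hρ1)
    have hzx := hzAB x hx
    exact ⟨by linarith [hzx.1], by linarith [hzx.2]⟩
  obtain ⟨q₀, hq₀, β, hβ, hpass⟩ := exists_passEstimates hr hg hgs hDs hfg (by linarith : α < 1)
    hκ (min_le_left _ _) hΛ1.le hΛ2 hρ hgρ' hDρ'
  refine ⟨q₀ ^ (r + 1), by positivity, fun ε hε hεq θ hθ => ?_⟩
  set q := ε ^ (1 / ((r : ℝ) + 1)) with hq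
  have hq0 : 0 < q := Real.rpow_pos_of_pos hε _
  have hqq : q ≤ q₀ := by
    rw [← rpow_one_div_succ_pow r hε.le, ← hq] at hεq
    exact (pow_le_pow_iff_left₀ hq0.le hq₀.le (Nat.succ_ne_zero r)).1 hεq
  have hstep := hpass ε hε hqq
  rw [← hq] at hstep
  have hinvar := pair_invariant hgc (η := η) hab hκ.le (mul_pos hβ hq0) hθ hK
    fun y hy => (hstep y hy).imp fun H h => ⟨h.1, h.2.2⟩
  have hreach : ∃ i, (pair f r α a b η ε θ i).1 = b := by
    by_contra hcon
    push Not at hcon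
    obtain ⟨n, hn⟩ := exists_nat_gt ((b - a) / (β * q))
    rw [div_lt_iff₀ (by positivity)] at hn
    obtain ⟨h1, h2, -⟩ := hinvar n fun j _ => hcon j
    linarith
  classical
  set N := Nat.find hreach with hN
  have hleast : StopsAfter f r α a b η ε θ N :=
    ⟨Nat.find_spec hreach, fun i hi => Nat.find_min' hreach hi⟩
  have hlocal : ∀ i < N, a ≤ (pair f r α a b η ε θ i).1 ∧ (pair f r α a b η ε θ i).1 < b ∧
      |(pair f r α a b η ε θ i).2 - z (pair f r α a b η ε θ i).1| ≤ ρ ∧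
      (pair f r α a b η ε θ i).2 ∈ Set.Icc (A - 1) (B + 1) := by
    intro i hi
    obtain ⟨h1, h2, h3⟩ := hinvar i fun j hj => Nat.find_min hreach (lt_of_le_of_lt hj hi)
    have hax : a ≤ (pair f r α a b η ε θ i).1 := by
      have : 0 ≤ (i : ℝ) * (β * q) := by positivity
      linarith
    have h4 := h3.trans (by gcongr : _ ≤ κ * (b - a))
    exact ⟨hax, h2, hnear _ ⟨hax, h2.le⟩ _ h4, hK _ ⟨hax, h2.le⟩ _ h4⟩
  refine ⟨N, hleast, ?_, ?_⟩
  · intro i hi zi hzi hzi0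
    obtain ⟨hax, hxb, -, hyK⟩ := hlocal i hi
    obtain ⟨H, hH, -, hE⟩ := hstep _ hyK
    obtain ⟨e1, e2, -⟩ := hE _ b (θ i) hxb (hθ i) _ (pair_succ f r α a b η ε θ i)
    have hH0 : 0 < H := lt_of_lt_of_le (by positivity) hH
    have hle : (pair f r α a b η ε θ i).1 ≤ (pair f r α a b η ε θ (i + 1)).1 := by
      rw [e1]; exact le_min hxb.le (by linarith)
    have hint := integral_along_integralCurve hgc hg0 hfg hzi (Set.left_mem_Icc.2 hle)
      (Set.right_mem_Icc.2 hle)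
    rw [hzi0] at hint
    refine (e2 _ hint).trans ?_
    have hΛ3 : Λ ^ 3 ≤ 1 + α := by
      rw [← hΛpow]; exact pow_le_pow_right₀ hΛ1.le (by omega)
    gcongr
  · have hcost : totalCost f r α a b η ε θ N = 2 * r * N := by
      simp only [totalCost, step_cost f hr, Finset.sum_const, Finset.card_range, smul_eq_mul]
      ring
    rw [hcost]
    refine Nat.mul_le_mul_left _ ?_
    obtain ⟨hm1, hmk⟩ := Nat.sInf_mem
      (exists_kStar_le (r := r) (g := g) hab.le hε (fun y hy => (hMb y hy).2) hzAB)
    change 1 ≤ mOf r g z a b ε at hm1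
    change kStar r g z a b (mOf r g z a b ε) ≤ ε at hmk
    by_contra hlt
    push Not at hlt
    have hα' : 0 < 1 - α ^ 2 := by nlinarith
    -- The safety factor `1 - α` outweighs the loss `Λ^(r+4) = 1 + α`: their product `1 - α²` is
    -- below `1`. This strict gap survives the infimum over meshes and contradicts `hmk`.
    have hlower : ε / (1 - α ^ 2) ≤ kStar r g z a b (mOf r g z a b ε) := by
      refine le_kStar hg hg0 hfg hab.le hz hm1
        (X := fun i => (pair f r α a b η ε θ i).1) rfl (hlocal _ hlt).2.1 fun i hi => ?_
      obtain ⟨hax, hxb, hzy, hyK⟩ := hlocal i (by omega)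
      obtain ⟨-, hxb', -, -⟩ := hlocal (i + 1) (by omega)
      obtain ⟨H, hH, hφ, hE⟩ := hstep _ hyK
      obtain ⟨e1, -, -⟩ := hE _ b (θ i) hxb (hθ i) _ (pair_succ f r α a b η ε θ i)
      have hH0 : 0 < H := lt_of_lt_of_le (by positivity) hH
      have hx' : (pair f r α a b η ε θ (i + 1)).1 = (pair f r α a b η ε θ i).1 + H := by
        rcases min_choice b ((pair f r α a b η ε θ i).1 + H) with h | h
        · exact absurd (e1.trans h) hxb'.ne
        · exact e1.trans h
      simp only [hx', add_sub_cancel_left]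
      refine ⟨by linarith, ?_⟩
      have hzx := hzAB _ ⟨hax, hxb.le⟩
      have hzK : z (pair f r α a b η ε θ i).1 ∈ Set.Icc (A - 1) (B + 1) :=
        ⟨by linarith [hzx.1], by linarith [hzx.2]⟩
      have hdens := density_le_of_nearlyConstant hg0 hΛ0 (hgρ' _ hzK) (hDρ' _ hzK) hzy
      rw [div_le_iff₀ hα']
      set x := (pair f r α a b η ε θ i).1
      set y := (pair f r α a b η ε θ i).2
      calc ε ≤ Λ * (density r g y * |constC r| / r.factorial * (1 - α) * H ^ (r + 1)) := hφ
        _ ≤ Λ * (Λ ^ (r + 3) * density r g (z x) * |constC r| / r.factorial * (1 - α)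
              * H ^ (r + 1)) := by gcongr
        _ = Λ ^ (r + 4) * (1 - α) * (density r g (z x) * |constC r| / r.factorial
              * H ^ (r + 1)) := by ring
        _ = _ := by rw [hΛpow]; ring
    have hstrict : ε < ε / (1 - α ^ 2) := by
      rw [lt_div_iff₀ hα']
      have := mul_pos hε (pow_pos hα0 2)
      linarith
    linarith
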